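/- **Setting.** An MV-algebra is an algebra $\langle A,\oplus,{}^*,0\rangle$ such that $\langle A,\oplus,0\rangle$ is a commutative monoid, $a^{**}=a$, $a\oplus 0^*=0^*$ and $(a^*\oplus b)^*\oplus b=(b^*\oplus a)^*\oplus a$; put $1=0^*$, $a\odot b=(a^*\oplus b^*)^*$, $a\ominus b=a\odot b^*$, and $a\le b$ iff $a^*\oplus b=1$. The interval $[0,1]$ is an MV-algebra with $x\oplus y=\min(1,x+y)$ and $x^*=1-x$; $[0,1]^X$ has the pointwise operations. $\mathcal{MV}$ is the category of MV-algebras. An ideal is a down-set that contains $0$ and is closed under $\oplus$; $\operatorname{Max}A$ is the set of maximal (proper) ideals of $A$. For $M\in\operatorname{Max}A$ there is a unique embedding $\iota_M:A/M\to[0,1]$; put $\widehat a(M)=\iota_M(a/M)$. A simple MV-algebra is one whose only proper ideal is $\{0\}$; a semisimple one is a subdirect product of simple ones. A cut $X=luX$ of a semisimple $A$ ($u$, $l$ denote sets of upper and lower bounds) is a limit cut if $\bigwedge\{\widehat b\ominus\widehat a : a\in X,\ b\in uX\}=0$ in $[0,1]^{\operatorname{Max}A}$, and $A$ is limit cut complete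 if each of its limit cuts has a supremum in $A$. An MV-topological space is a pair $\langle X,\Omega\rangle$ with $\Omega\subseteq[0,1]^X$ containing $0,1$ and closed under arbitrary joins and under binary $\oplus,\odot,\wedge$; closed MV-sets are the $o^*$ with $o\in\Omega$; a map $f$ is continuous if $o\circ f$ is open for each open $o$. The space is a Stone MV-space if it is compact (each $\Gamma\subseteq\Omega$ with $\bigvee\Gamma=1$ contains a finite family, repetitions allowed, with $o_1\oplus\dots\oplus o_n=1$), separated (for $x\ne y$ there are open $o,o'$ with $o(x)=o'(y)=1$ and $o\wedge o'=0$), and every open set is a join of clopen sets. It is crisp if all its open sets are $\{0,1\}$-valued. The contravariant functor $\operatorname{Clop}$ sends an MV-topological space to the MV-algebra of its clopen sets and $f$ to $o\mapsto o\circ f$. The contravariant functor $\operatorname{Max}$ sends an MV-algebra $A$ to the space $\operatorname{Max}A$ whose open sets are the joins of sets of functions $\widehat a$, $a\in A$, and $h$ to $N\mapsto h^{-1}[N]$. There are natural maps $\tau\to\operatorname{Max}\operatorname{Clop}\tau$, $x\mapsto\{o: o(x)=0\}$, and $A\to\operatorname{Clop}\operatorname{Max}A$, $a\mapsto\widehat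 a$; these are the data of the Clop/Max duality between limit cut complete MV-algebras and Stone MV-spaces. **Corollary 4.10.** The restriction of the Clop/Max duality to Boolean algebras and crisp topologies is the classical Stone duality. That is: 1. Regarding a Boolean algebra as an MV-algebra with $\oplus=\vee$ and ${}^*$ the complement embeds the category of Boolean algebras as a full subcategory of $\mathcal{MV}$. Its objects are, up to isomorphism, the MV-algebras with $a\oplus a=a$ for all $a$, and all of them are limit cut complete. Regarding a Stone space (compact, Hausdorff, totally disconnected) as the MV-topological space whose open sets are the characteristic functions of its open sets embeds the category of Stone spaces as a full subcategory of that of MV-topological spaces, whose objects are, up to isomorphism, the crisp Stone MV-spaces. 2. On Boolean algebras, $\operatorname{Max}$ is, naturally and via the identity map on maximal ideals, the functor that sends $B$ to the Stone space of its maximal ideals with the topology generated by the sets $\{M: b\notin M\}$, $b\in B$, and a homomorphism to the preimage map. On Stone spaces, $\operatorname{Clop}$ is, naturally and via the identification of clopen sets with their characteristic functions, the functor that sends $X$ to the Boolean algebra of its clopen subsets and a continuous map to the preimage map. 3. The two classical functors in 2 form a dual equivalence between Boolean algebras and Stone spaces, with unit $x\mapsto\{U \text{ clopen}: x\notin U\}$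 and counit $b\mapsto\{M: b\notin M\}$, and under the identifications in 2 these are the natural maps $\tau\to\operatorname{Max}\operatorname{Clop}\tau$ and $A\to\operatorname{Clop}\operatorname{Max}A$. 4. The map $M\mapsto B\setminus M$ is a natural homeomorphism from the space of maximal ideals in 2 onto the space of ultrafilters of $B$ with the topology generated by the sets $\{F: b\in F\}$, $b\in B$. -/

import Mathlib

universe u v w

open CategoryTheory Opposite

/-- An MV-algebra `(A, ⊕, *, 0)`. -/
class MVAlgebra (A : Type u) where
  oplus : A → A → A
  star : A → A
  zero : A
  oplus_assoc : ∀ a b c : A, oplus (oplus a b) c = oplus a (oplus b c)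
  oplus_comm : ∀ a b : A, oplus a b = oplus b a
  oplus_zero : ∀ a : A, oplus a zero = a
  star_star : ∀ a : A, star (star a) = a
  oplus_star_zero : ∀ a : A, oplus a (star zero) = star zero
  lukasiewicz : ∀ a b : A, oplus (star (oplus (star a) b)) b = oplus (star (oplus (star b) a)) a

namespace MVAlgebra

infixl:65 " ⊕ᵐ " => MVAlgebra.oplus
postfix:max "⋆" => MVAlgebra.star

/-- The top element `1 = 0*`. -/
def one {A : Type u} [MVAlgebra A] : A := (zero : A)⋆

/-- The strong conjunction `a ⊙ b = (a* ⊕ b*)*`. -/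
def odot {A : Type u} [MVAlgebra A] (a b : A) : A := (a⋆ ⊕ᵐ b⋆)⋆

infixl:70 " ⊙ᵐ " => MVAlgebra.odot

/-- The difference `a ⊖ b = a ⊙ b*`. -/
def ominus {A : Type u} [MVAlgebra A] (a b : A) : A := a ⊙ᵐ b⋆

infixl:65 " ⊖ᵐ " => MVAlgebra.ominus

/-- The natural order: `a ≤ b` iff `a* ⊕ b = 1`. -/
def le {A : Type u} [MVAlgebra A] (a b : A) : Prop := a⋆ ⊕ᵐ b = one

infix:50 " ≼ " => MVAlgebra.le

/-- The lattice join `a ∨ b = (a ⊖ b) ⊕ b`. -/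
def sup {A : Type u} [MVAlgebra A] (a b : A) : A := (a ⊖ᵐ b) ⊕ᵐ b

/-- The lattice meet `a ∧ b = (a* ∨ b*)*`. -/
def inf {A : Type u} [MVAlgebra A] (a b : A) : A := (sup a⋆ b⋆)⋆

section Lemmas

variable {A : Type u} [MVAlgebra A]

theorem zero_oplus (a : A) : zero ⊕ᵐ a = a := by rw [oplus_comm, oplus_zero]

theorem oplus_one (a : A) : a ⊕ᵐ one = one := oplus_star_zero a

theorem one_oplus (a : A) : one ⊕ᵐ a = one := by rw [oplus_comm, oplus_one]

theorem star_one : (one : A)⋆ = zero := star_star _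

theorem star_zero : (zero : A)⋆ = one := rfl

theorem star_inj {a b : A} (h : a⋆ = b⋆) : a = b := by
  rw [← star_star a, h, star_star]

theorem oplus_left_comm (a b c : A) : a ⊕ᵐ (b ⊕ᵐ c) = b ⊕ᵐ (a ⊕ᵐ c) := by
  rw [← oplus_assoc, oplus_comm a b, oplus_assoc]

theorem star_oplus_self (a : A) : a⋆ ⊕ᵐ a = one := by
  have h := lukasiewicz a one
  rwa [oplus_one, star_one, zero_oplus, eq_comm] at h

theorem oplus_star_self (a : A) : a ⊕ᵐ a⋆ = one := by rw [oplus_comm, star_oplus_self]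

theorem star_odot (a b : A) : (a ⊙ᵐ b)⋆ = a⋆ ⊕ᵐ b⋆ := star_star _

theorem star_ominus (a b : A) : (a ⊖ᵐ b)⋆ = a⋆ ⊕ᵐ b := by
  rw [ominus, star_odot, star_star]

theorem odot_comm (a b : A) : a ⊙ᵐ b = b ⊙ᵐ a := by rw [odot, oplus_comm, odot]

theorem odot_assoc (a b c : A) : a ⊙ᵐ b ⊙ᵐ c = a ⊙ᵐ (b ⊙ᵐ c) := by
  simp only [odot, star_star, oplus_assoc]

theorem le_refl (a : A) : a ≼ a := star_oplus_self a

theorem le_antisymm {a b : A} (h : a ≼ b) (h' : b ≼ a) : a = b := by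
  have := lukasiewicz a b
  rw [le] at h h'
  rwa [h, h', star_one, zero_oplus, zero_oplus, eq_comm] at this

theorem le_oplus_left (a b : A) : a ≼ a ⊕ᵐ b := by
  rw [le, ← oplus_assoc, star_oplus_self, one_oplus]

theorem le_oplus_right (a b : A) : b ≼ a ⊕ᵐ b := by
  rw [oplus_comm]; exact le_oplus_left b a

theorem oplus_ominus_of_le {a b : A} (h : a ≼ b) : (b ⊖ᵐ a) ⊕ᵐ a = b := by
  have := lukasiewicz a b
  rw [le] at h
  rw [h, star_one, zero_oplus] at this
  rw [← star_star (b ⊖ᵐ a), star_ominus, ← this]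

theorem le_trans {a b c : A} (h : a ≼ b) (h' : b ≼ c) : a ≼ c := by
  rw [← oplus_ominus_of_le h', ← oplus_ominus_of_le h, ← oplus_assoc]
  exact le_oplus_right _ _

theorem oplus_le_oplus_left {a b : A} (h : a ≼ b) (c : A) : c ⊕ᵐ a ≼ c ⊕ᵐ b := by
  rw [← oplus_ominus_of_le h, oplus_left_comm]
  exact le_oplus_right _ _

theorem oplus_le_oplus {a b c d : A} (h : a ≼ b) (h' : c ≼ d) : a ⊕ᵐ c ≼ b ⊕ᵐ d := by
  refine le_trans (oplus_le_oplus_left h' a) ?_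
  rw [oplus_comm a, oplus_comm b]
  exact oplus_le_oplus_left h d

theorem star_le_star {a b : A} (h : a ≼ b) : b⋆ ≼ a⋆ := by
  rw [le, star_star, oplus_comm]; exact h

theorem ominus_le_iff {a b c : A} : a ⊖ᵐ b ≼ c ↔ a ≼ b ⊕ᵐ c := by
  rw [le, star_ominus, oplus_assoc, le]

theorem zero_le (a : A) : zero ≼ a := one_oplus a

theorem le_one (a : A) : a ≼ one := oplus_one _

theorem le_zero {a : A} (h : a ≼ zero) : a = zero := le_antisymm h (zero_le a)

theorem one_le {a : A} (h : one ≼ a) : a = one := le_antisymm (le_one a) h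

theorem ominus_eq_zero {a b : A} : a ⊖ᵐ b = zero ↔ a ≼ b := by
  constructor
  · intro h
    have : a ⊖ᵐ b ≼ zero := by rw [h]; exact le_refl _
    rwa [ominus_le_iff, oplus_zero] at this
  · intro h
    exact le_zero (ominus_le_iff.2 (by rwa [oplus_zero]))

theorem ominus_le_left (a b : A) : a ⊖ᵐ b ≼ a := ominus_le_iff.2 (le_oplus_right _ _)

theorem odot_le_left (a b : A) : a ⊙ᵐ b ≼ a := by
  have := ominus_le_left a b⋆
  rwa [ominus, star_star] at this

theorem odot_le_right (a b : A) : a ⊙ᵐ b ≼ b := by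
  rw [odot_comm]; exact odot_le_left b a

theorem ominus_le_ominus_right {a b : A} (h : a ≼ b) (c : A) : a ⊖ᵐ c ≼ b ⊖ᵐ c :=
  ominus_le_iff.2 (le_trans h (ominus_le_iff.1 (le_refl _)))

theorem sup_comm (a b : A) : sup a b = sup b a := by
  have := lukasiewicz a b
  rw [← star_ominus a b, ← star_ominus b a, star_star, star_star] at this
  exact this

theorem le_sup_right (a b : A) : b ≼ sup a b := le_oplus_right _ _

theorem le_sup_left (a b : A) : a ≼ sup a b := by rw [sup_comm]; exact le_sup_right _ _

theorem sup_le {a b c : A} (h : a ≼ c) (h' : b ≼ c) : sup a b ≼ c := by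
  have := oplus_le_oplus (ominus_le_ominus_right h b) (le_refl b)
  rwa [oplus_ominus_of_le h'] at this

theorem inf_comm (a b : A) : inf a b = inf b a := by rw [inf, sup_comm, inf]

theorem inf_le_left (a b : A) : inf a b ≼ a := by
  have := star_le_star (le_sup_left a⋆ b⋆)
  rwa [star_star] at this

theorem inf_le_right (a b : A) : inf a b ≼ b := by rw [inf_comm]; exact inf_le_left _ _

theorem le_inf {a b c : A} (h : c ≼ a) (h' : c ≼ b) : c ≼ inf a b := by
  have := star_le_star (sup_le (star_le_star h) (star_le_star h'))
  rwa [star_star] at this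

/-- `a ∧ b = a ⊙ (a* ⊕ b)`. -/
theorem inf_eq (a b : A) : inf a b = a ⊙ᵐ (a⋆ ⊕ᵐ b) := by
  rw [inf_comm, inf, sup, oplus_comm, odot, ominus, odot, star_star, star_star, oplus_comm b]

theorem inf_oplus_eq_zero {a b c : A} (h : inf a c = zero) (h' : inf b c = zero) :
    inf (a ⊕ᵐ b) c = zero := by
  have h1 : inf (a ⊕ᵐ b) c ⊖ᵐ a ≼ zero := by
    rw [← h']
    exact le_inf (ominus_le_iff.2 (inf_le_left _ _)) (ominus_le_iff.2
      (le_trans (inf_le_right _ _) (le_oplus_right _ _)))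
  rw [ominus_le_iff, oplus_zero] at h1
  apply le_zero
  rw [← h]
  exact le_inf h1 (inf_le_right _ _)

theorem odot_le_odot_left {a b : A} (h : a ≼ b) (c : A) : c ⊙ᵐ a ≼ c ⊙ᵐ b :=
  star_le_star (oplus_le_oplus_left (star_le_star h) _)

theorem odot_star_self (a : A) : a ⊙ᵐ a⋆ = zero := by
  rw [odot, star_star, star_oplus_self, star_one]

theorem inf_ominus (a b : A) : inf (a ⊖ᵐ b) (b ⊖ᵐ a) = zero := by
  have e1 : inf (a ⊖ᵐ b) (b ⊖ᵐ a) = (inf a (b ⊕ᵐ (b ⊖ᵐ a))) ⊙ᵐ b⋆ := by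
    rw [inf_eq, inf_eq, star_ominus, oplus_assoc, ominus, odot_assoc, odot_assoc,
      odot_comm b⋆]
  have e2 : inf a (b ⊕ᵐ (b ⊖ᵐ a)) ⊙ᵐ b⋆ =
      inf b⋆ (b ⊖ᵐ a) ⊙ᵐ ((b ⊕ᵐ (b ⊖ᵐ a))⋆ ⊕ᵐ a) := by
    rw [inf_comm a, inf_eq, inf_eq b⋆, star_star, odot_assoc, odot_comm _ b⋆, ← odot_assoc,
      odot_comm b⋆]
  rw [e1, e2]
  apply le_zero
  rw [odot_comm]
  refine le_trans (odot_le_odot_left (inf_le_right _ _) _) ?_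
  have e3 : ((b ⊕ᵐ (b ⊖ᵐ a))⋆ ⊕ᵐ a) ⊙ᵐ (b ⊖ᵐ a) = b ⊙ᵐ inf a⋆ (b ⊕ᵐ (b ⊖ᵐ a))⋆ := by
    rw [inf_eq, star_star, oplus_comm a, odot_comm]
    nth_rewrite 1 [ominus]
    rw [odot_assoc]
  rw [e3]
  refine le_trans (odot_le_odot_left (inf_le_right _ _) _) ?_
  refine le_trans (odot_le_odot_left (star_le_star (le_oplus_left _ _)) _) ?_
  rw [odot_star_self]
  exact le_refl _

end Lemmas
end MVAlgebra

section

open MVAlgebra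

/-- Homomorphisms of MV-algebras. -/
@[ext]
structure MVHom (A : Type u) (B : Type v) [MVAlgebra A] [MVAlgebra B] where
  toFun : A → B
  map_oplus : ∀ a b, toFun (a ⊕ᵐ b) = toFun a ⊕ᵐ toFun b
  map_star : ∀ a, toFun a⋆ = (toFun a)⋆
  map_zero : toFun MVAlgebra.zero = MVAlgebra.zero

namespace MVHom

variable {A : Type u} {B : Type v} {C : Type w} [MVAlgebra A] [MVAlgebra B] [MVAlgebra C]

instance : CoeFun (MVHom A B) (fun _ => A → B) := ⟨MVHom.toFun⟩

/-- The identity homomorphism. -/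
def id (A : Type u) [MVAlgebra A] : MVHom A A := ⟨fun a => a, fun _ _ => rfl, fun _ => rfl, rfl⟩

/-- Composition of homomorphisms. -/
def comp (g : MVHom B C) (f : MVHom A B) : MVHom A C where
  toFun a := g (f a)
  map_oplus a b := by rw [f.map_oplus, g.map_oplus]
  map_star a := by rw [f.map_star, g.map_star]
  map_zero := by rw [f.map_zero, g.map_zero]

theorem map_one (f : MVHom A B) : f MVAlgebra.one = MVAlgebra.one := by
  rw [MVAlgebra.one, f.map_star, f.map_zero, MVAlgebra.one]

theorem map_odot (f : MVHom A B) (a b : A) : f (a ⊙ᵐ b) = f a ⊙ᵐ f b := by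
  simp only [MVAlgebra.odot, f.map_star, f.map_oplus]

theorem map_ominus (f : MVHom A B) (a b : A) : f (a ⊖ᵐ b) = f a ⊖ᵐ f b := by
  simp only [MVAlgebra.ominus, f.map_star, f.map_odot]

theorem map_sup (f : MVHom A B) (a b : A) :
    f (MVAlgebra.sup a b) = MVAlgebra.sup (f a) (f b) := by
  simp only [MVAlgebra.sup, f.map_ominus, f.map_oplus]

theorem map_inf (f : MVHom A B) (a b : A) :
    f (MVAlgebra.inf a b) = MVAlgebra.inf (f a) (f b) := by
  simp only [MVAlgebra.inf, f.map_sup, f.map_star]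

theorem map_le (f : MVHom A B) {a b : A} (h : a ≼ b) : f a ≼ f b := by
  rw [MVAlgebra.le] at h ⊢
  rw [← f.map_star, ← f.map_oplus, h, f.map_one]

end MVHom

/-- Ideals of an MV-algebra: down-sets containing `0` and closed under `⊕`. -/
@[ext]
structure MVIdeal (A : Type u) [MVAlgebra A] where
  carrier : Set A
  zero_mem : MVAlgebra.zero ∈ carrier
  oplus_mem : ∀ {a b}, a ∈ carrier → b ∈ carrier → a ⊕ᵐ b ∈ carrier
  mem_of_le : ∀ {a b}, a ≼ b → b ∈ carrier → a ∈ carrier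

namespace MVIdeal

variable {A : Type u} [MVAlgebra A]

instance : Membership A (MVIdeal A) := ⟨fun I a => a ∈ I.carrier⟩

/-- A proper ideal is one different from the whole algebra. -/
def IsProper (I : MVIdeal A) : Prop := I.carrier ≠ Set.univ

/-- A maximal ideal is a maximal element among the proper ideals. -/
def IsMaximal (I : MVIdeal A) : Prop :=
  I.IsProper ∧ ∀ J : MVIdeal A, J.IsProper → I.carrier ⊆ J.carrier → I = J

theorem isProper_iff (I : MVIdeal A) : I.IsProper ↔ MVAlgebra.one ∉ I := by
  constructor
  · intro h h1
    exact h (Set.eq_univ_of_forall fun a => I.mem_of_le (MVAlgebra.le_one a) h1)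
  · intro h h1
    exact h (show _ ∈ I.carrier by rw [h1]; trivial)

end MVIdeal

/-- The maximal spectrum of an MV-algebra. -/
def MaxSpec (A : Type u) [MVAlgebra A] : Type u := {M : MVIdeal A // M.IsMaximal}

/-- The underlying set of a maximal ideal. -/
def MaxSpec.carrier {A : Type u} [MVAlgebra A] (M : MaxSpec A) : Set A := M.1.carrier

/-- The kernel of a homomorphism. -/
def MVHom.ker {A : Type u} {B : Type v} [MVAlgebra A] [MVAlgebra B] (f : MVHom A B) :
    MVIdeal A where
  carrier := {a | f a = MVAlgebra.zero}
  zero_mem := f.map_zero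
  oplus_mem := by
    intro a b ha hb
    rw [Set.mem_ofPred_eq] at *
    rw [f.map_oplus, ha, hb, MVAlgebra.oplus_zero]
  mem_of_le := by
    intro a b h hb
    have := f.map_le h
    rw [Set.mem_ofPred_eq] at *
    rw [hb] at this
    exact MVAlgebra.le_zero this

namespace MVAlgebra

/-- The standard MV-algebra `[0, 1]`: `x ⊕ y = min (1, x + y)` and `x* = 1 - x`. -/
noncomputable instance instUnitInterval : MVAlgebra unitInterval where
  oplus x y := ⟨min 1 (x + y), le_min zero_le_one (add_nonneg x.2.1 y.2.1), min_le_left _ _⟩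
  star x := ⟨1 - x, sub_nonneg.2 x.2.2, sub_le_self _ x.2.1⟩
  zero := 0
  oplus_assoc a b c := by
    have := a.2.1; have := b.2.1; have := c.2.1
    apply Subtype.ext; simp only [min_def]; split_ifs <;> linarith
  oplus_comm a b := by apply Subtype.ext; simp only [add_comm]
  oplus_zero a := by
    have := a.2.2
    apply Subtype.ext; simpa using this
  star_star a := by apply Subtype.ext; simp
  oplus_star_zero a := by
    have := a.2.1
    apply Subtype.ext; simpa using this
  lukasiewicz a b := by
    have := a.2.1; have := b.2.1; have := a.2.2; have := b.2.2
    apply Subtype.ext; simp only [min_def]; split_ifs <;> linarith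

theorem coe_oplus (x y : unitInterval) : ((x ⊕ᵐ y : unitInterval) : ℝ) = min 1 ((x : ℝ) + y) := rfl

theorem coe_star (x : unitInterval) : ((x⋆ : unitInterval) : ℝ) = 1 - x := rfl

theorem coe_zero : ((zero : unitInterval) : ℝ) = 0 := rfl

theorem coe_one : ((one : unitInterval) : ℝ) = 1 := sub_zero 1

theorem coe_odot (x y : unitInterval) :
    ((x ⊙ᵐ y : unitInterval) : ℝ) = max 0 ((x : ℝ) + y - 1) := by
  rw [odot, coe_star, coe_oplus, coe_star, coe_star, min_def, max_def]
  split_ifs <;> linarith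

theorem coe_ominus (x y : unitInterval) :
    ((x ⊖ᵐ y : unitInterval) : ℝ) = max 0 ((x : ℝ) - y) := by
  rw [ominus, coe_odot, coe_star]; congr 1; ring

theorem coe_sup (x y : unitInterval) : ((sup x y : unitInterval) : ℝ) = max (x : ℝ) y := by
  have := x.2.2; have := y.2.2
  rw [sup, coe_oplus, coe_ominus, min_def, max_def, max_def]
  split_ifs <;> linarith

theorem coe_inf (x y : unitInterval) : ((inf x y : unitInterval) : ℝ) = min (x : ℝ) y := by
  rw [inf, coe_star, coe_sup, coe_star, coe_star, min_def, max_def]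
  split_ifs <;> linarith

/-- Products of MV-algebras, with pointwise operations. -/
instance instPi {ι : Type u} {A : ι → Type v} [∀ i, MVAlgebra (A i)] : MVAlgebra (∀ i, A i) where
  oplus f g i := f i ⊕ᵐ g i
  star f i := (f i)⋆
  zero _ := zero
  oplus_assoc _ _ _ := funext fun _ => oplus_assoc _ _ _
  oplus_comm _ _ := funext fun _ => oplus_comm _ _
  oplus_zero _ := funext fun _ => oplus_zero _
  star_star _ := funext fun _ => star_star _
  oplus_star_zero _ := funext fun _ => oplus_star_zero _
  lukasiewicz _ _ := funext fun _ => lukasiewicz _ _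

/-- The `n`-fold sum `n a = a ⊕ ⋯ ⊕ a`. -/
def nmul {A : Type u} [MVAlgebra A] : ℕ → A → A
  | 0, _ => zero
  | n + 1, a => nmul n a ⊕ᵐ a

end MVAlgebra


theorem MVHom.map_nmul {A : Type u} {B : Type v} [MVAlgebra A] [MVAlgebra B] (f : MVHom A B)
    (n : ℕ) (a : A) : f (nmul n a) = nmul n (f a) := by
  induction n with
  | zero => exact f.map_zero
  | succ n ih => rw [nmul, f.map_oplus, ih, nmul]

theorem MVIdeal.nmul_mem {A : Type u} [MVAlgebra A] (I : MVIdeal A) {a : A} (h : a ∈ I) (n : ℕ) :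
    nmul n a ∈ I := by
  induction n with
  | zero => exact I.zero_mem
  | succ n ih => exact I.oplus_mem ih h

theorem MVAlgebra.coe_nmul (n : ℕ) (x : unitInterval) :
    ((nmul n x : unitInterval) : ℝ) = min 1 ((n : ℝ) * x) := by
  induction n with
  | zero => simp [nmul, coe_zero]
  | succ n ih =>
    have := x.2.1
    rw [nmul, coe_oplus, ih]
    push_cast
    have h2 : (0 : ℝ) ≤ n * x := by positivity
    rw [min_def, min_def, min_def]; split_ifs <;> linarith

theorem MVHom.ker_isMaximal {A : Type u} [MVAlgebra A] (f : MVHom A unitInterval) :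
    f.ker.IsMaximal := by
  constructor
  · rw [MVIdeal.isProper_iff]
    intro h
    have h : f one = zero := h
    rw [f.map_one] at h
    have := congrArg Subtype.val h
    rw [coe_one, coe_zero] at this
    exact one_ne_zero this
  · intro J hJ hle
    ext a
    refine ⟨fun h => hle h, fun h => ?_⟩
    by_contra hn
    have hpos : (0 : ℝ) < f a := lt_of_le_of_ne (f a).2.1 fun h0 => hn (Subtype.ext h0.symm)
    obtain ⟨n, hn⟩ := Archimedean.arch (1 : ℝ) hpos
    rw [nsmul_eq_mul] at hn
    have h1 : nmul n (f a) = one := Subtype.ext (by rw [coe_nmul, min_eq_left hn, coe_one])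
    have h2 : (nmul n a)⋆ ∈ J := hle (show f _ = _ by rw [f.map_star, f.map_nmul, h1, MVAlgebra.star_one])
    have h3 := J.oplus_mem (J.nmul_mem h n) h2
    rw [oplus_star_self] at h3
    exact (MVIdeal.isProper_iff J).1 hJ h3

/-- Two homomorphisms into `[0, 1]` with the same kernel are equal. -/
theorem MVHom.eq_of_ker_eq {A : Type u} [MVAlgebra A] (f g : MVHom A unitInterval)
    (h : f.ker = g.ker) : f = g := by
  have key : ∀ n : ℕ, ∀ (f g : MVHom A unitInterval), f.ker = g.ker → ∀ a : A,
      (1 : ℝ) ≤ 2 ^ n * ((g a : ℝ) - f a) → False := by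
    intro n
    induction n with
    | zero =>
      intro f g h a ha
      have h1 := (g a).2.2
      have h2 := (f a).2.1
      have h3 : a ∈ f.ker := Subtype.ext (by rw [coe_zero]; linarith)
      rw [h] at h3
      have h4 := congrArg Subtype.val (show g a = zero from h3)
      rw [coe_zero] at h4
      linarith
    | succ n ih =>
      intro f g h a ha
      rw [pow_succ, mul_assoc] at ha
      have f0 := (f a).2.1; have f1 := (f a).2.2; have g0 := (g a).2.1; have g1 := (g a).2.2
      have hp : (0 : ℝ) < 2 ^ n := by positivity
      have hlt : (f a : ℝ) < g a := by
        by_contra hc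
        have : 2 ^ n * (2 * ((g a : ℝ) - f a)) ≤ 0 :=
          mul_nonpos_of_nonneg_of_nonpos hp.le (by linarith)
        linarith
      rcases le_or_gt ((g a : ℝ)) (1 / 2) with hg | hg
      · refine ih f g h (a ⊕ᵐ a) ?_
        rw [g.map_oplus, f.map_oplus, coe_oplus, coe_oplus, min_eq_right (by linarith),
          min_eq_right (by linarith)]
        convert ha using 2; ring
      · rcases le_or_gt ((1 : ℝ) / 2) (f a) with hf | hf
        · refine ih f g h (a ⊙ᵐ a) ?_
          rw [g.map_odot, f.map_odot, coe_odot, coe_odot, max_eq_right (by linarith),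
            max_eq_right (by linarith)]
          convert ha using 2; ring
        · have h3 : a ⊙ᵐ a ∈ f.ker := Subtype.ext (by
            rw [f.map_odot, coe_odot, coe_zero]; exact max_eq_left (by linarith))
          rw [h] at h3
          have h4 := congrArg Subtype.val (show g (a ⊙ᵐ a) = zero from h3)
          rw [g.map_odot, coe_odot, coe_zero, max_eq_right (by linarith)] at h4
          linarith
  have le : ∀ (f g : MVHom A unitInterval), f.ker = g.ker → ∀ a : A, (g a : ℝ) ≤ f a := by
    intro f g h a
    by_contra hc
    rw [not_le] at hc
    obtain ⟨n, hn⟩ := pow_unbounded_of_one_lt (1 / ((g a : ℝ) - f a)) (one_lt_two)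
    rw [div_lt_iff₀ (by linarith)] at hn
    exact key n f g h a hn.le
  ext a
  exact le_antisymm (le g f h.symm a) (le f g h a)

namespace MVAlgebra

variable {A : Type u} [MVAlgebra A]

theorem ominus_le_trans (a b c : A) : a ⊖ᵐ c ≼ (a ⊖ᵐ b) ⊕ᵐ (b ⊖ᵐ c) := by
  rw [ominus_le_iff]
  have h1 : a ≼ b ⊕ᵐ (a ⊖ᵐ b) := ominus_le_iff.1 (le_refl _)
  have h2 : b ≼ c ⊕ᵐ (b ⊖ᵐ c) := ominus_le_iff.1 (le_refl _)
  refine le_trans h1 ?_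
  rw [oplus_comm b, oplus_left_comm]
  exact oplus_le_oplus_left h2 _

theorem star_ominus_star (a b : A) : a⋆ ⊖ᵐ b⋆ = b ⊖ᵐ a := by
  rw [ominus, ominus, star_star, odot_comm]

theorem oplus_ominus_oplus_le (a b c d : A) :
    (a ⊕ᵐ c) ⊖ᵐ (b ⊕ᵐ d) ≼ (a ⊖ᵐ b) ⊕ᵐ (c ⊖ᵐ d) := by
  rw [ominus_le_iff]
  have h1 : a ≼ b ⊕ᵐ (a ⊖ᵐ b) := ominus_le_iff.1 (le_refl _)
  have h2 : c ≼ d ⊕ᵐ (c ⊖ᵐ d) := ominus_le_iff.1 (le_refl _)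
  have h3 := oplus_le_oplus h1 h2
  rwa [oplus_assoc, oplus_left_comm (a ⊖ᵐ b), ← oplus_assoc] at h3

/-- The congruence of an ideal: `a ∼ b` iff `a ⊖ b` and `b ⊖ a` lie in the ideal. -/
def idealSetoid (I : MVIdeal A) : Setoid A where
  r a b := a ⊖ᵐ b ∈ I ∧ b ⊖ᵐ a ∈ I
  iseqv :=
    { refl := fun a => by
        have : a ⊖ᵐ a = zero := ominus_eq_zero.2 (le_refl _)
        rw [this]; exact ⟨I.zero_mem, I.zero_mem⟩
      symm := fun h => ⟨h.2, h.1⟩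
      trans := fun h h' => ⟨I.mem_of_le (ominus_le_trans _ _ _) (I.oplus_mem h.1 h'.1),
        I.mem_of_le (ominus_le_trans _ _ _) (I.oplus_mem h'.2 h.2)⟩ }

end MVAlgebra

/-- The quotient MV-algebra `A / I`. -/
def MVQuotient {A : Type u} [MVAlgebra A] (I : MVIdeal A) : Type u := Quotient (idealSetoid I)

namespace MVQuotient

variable {A : Type u} [MVAlgebra A] (I : MVIdeal A)

instance : MVAlgebra (MVQuotient I) where
  oplus := Quotient.map₂ (fun a b => a ⊕ᵐ b) fun _ _ h _ _ h' =>
    ⟨I.mem_of_le (oplus_ominus_oplus_le _ _ _ _) (I.oplus_mem h.1 h'.1),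
      I.mem_of_le (oplus_ominus_oplus_le _ _ _ _) (I.oplus_mem h.2 h'.2)⟩
  star := Quotient.map (fun a => a⋆) fun a b h => by
    change a⋆ ⊖ᵐ b⋆ ∈ I ∧ b⋆ ⊖ᵐ a⋆ ∈ I
    rw [star_ominus_star, star_ominus_star]; exact ⟨h.2, h.1⟩
  zero := Quotient.mk _ zero
  oplus_assoc := by
    rintro ⟨a⟩ ⟨b⟩ ⟨c⟩; exact congrArg (Quotient.mk _) (oplus_assoc a b c)
  oplus_comm := by
    rintro ⟨a⟩ ⟨b⟩; exact congrArg (Quotient.mk _) (oplus_comm a b)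
  oplus_zero := by
    rintro ⟨a⟩; exact congrArg (Quotient.mk _) (oplus_zero a)
  star_star := by
    rintro ⟨a⟩; exact congrArg (Quotient.mk _) (star_star a)
  oplus_star_zero := by
    rintro ⟨a⟩; exact congrArg (Quotient.mk _) (oplus_star_zero a)
  lukasiewicz := by
    rintro ⟨a⟩ ⟨b⟩; exact congrArg (Quotient.mk _) (lukasiewicz a b)

/-- The natural projection `A → A / I`. -/
def proj : MVHom A (MVQuotient I) where
  toFun a := Quotient.mk _ a
  map_oplus _ _ := rfl
  map_star _ := rfl
  map_zero := rfl

theorem proj_surjective : Function.Surjective (proj I) := by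
  rintro ⟨a⟩; exact ⟨a, rfl⟩

theorem proj_eq_zero {a : A} : proj I a = zero ↔ a ∈ I := by
  have h0 : zero ⊖ᵐ a = zero := ominus_eq_zero.2 (zero_le a)
  have h1 : a ⊖ᵐ zero = a := le_antisymm (ominus_le_left _ _)
    (by have := ominus_le_iff.1 (le_refl (a ⊖ᵐ zero)); rwa [zero_oplus] at this)
  refine ⟨fun h => ?_, fun h => Quotient.sound ?_⟩
  · have : a ⊖ᵐ zero ∈ I := (Quotient.exact h : _ ∧ _).1
    rwa [h1] at this
  · change a ⊖ᵐ zero ∈ I ∧ zero ⊖ᵐ a ∈ I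
    rw [h0, h1]; exact ⟨h, I.zero_mem⟩

end MVQuotient

theorem MVIdeal.IsMaximal.exists_nmul {A : Type u} [MVAlgebra A] {M : MVIdeal A}
    (hM : M.IsMaximal) {a : A} (ha : a ∉ M) : ∃ n : ℕ, (nmul n a)⋆ ∈ M := by
  have nadd : ∀ m n : ℕ, nmul (m + n) a = nmul m a ⊕ᵐ nmul n a := by
    intro m n
    induction n with
    | zero => exact (oplus_zero _).symm
    | succ n ih => rw [← add_assoc, nmul, ih, nmul, oplus_assoc]
  let J : MVIdeal A :=
    { carrier := {x | ∃ n : ℕ, ∃ m ∈ M, x ≼ nmul n a ⊕ᵐ m}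
      zero_mem := ⟨0, zero, M.zero_mem, zero_le _⟩
      oplus_mem := by
        rintro x y ⟨n, m, hm, hx⟩ ⟨n', m', hm', hy⟩
        refine ⟨n + n', m ⊕ᵐ m', M.oplus_mem hm hm', ?_⟩
        have := oplus_le_oplus hx hy
        rwa [oplus_assoc, oplus_left_comm m, ← oplus_assoc, ← nadd] at this
      mem_of_le := by
        rintro x y hxy ⟨n, m, hm, hy⟩
        exact ⟨n, m, hm, le_trans hxy hy⟩ }
  have hMJ : M.carrier ⊆ J.carrier := fun x hx => ⟨0, x, hx, le_oplus_right _ _⟩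
  have haJ : a ∈ J := ⟨1, zero, M.zero_mem, by
    rw [nmul, nmul, zero_oplus, oplus_zero]; exact le_refl _⟩
  by_cases hJ : J.IsProper
  · have := hM.2 J hJ hMJ
    rw [← this] at haJ
    exact absurd haJ ha
  · rw [MVIdeal.isProper_iff, not_not] at hJ
    obtain ⟨n, m, hm, h1⟩ := hJ
    refine ⟨n, M.mem_of_le ?_ hm⟩
    rw [le, MVAlgebra.star_star]
    exact one_le h1

/-- The quotient by a maximal ideal is totally ordered. -/
theorem MVQuotient.le_total {A : Type u} [MVAlgebra A] {M : MVIdeal A}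
    (hM : M.IsMaximal) (x y : MVQuotient M) : x ≼ y ∨ y ≼ x := by
  obtain ⟨a, rfl⟩ := proj_surjective M x
  obtain ⟨b, rfl⟩ := proj_surjective M y
  rw [← ominus_eq_zero, ← ominus_eq_zero, ← MVHom.map_ominus, ← MVHom.map_ominus,
    proj_eq_zero, proj_eq_zero]
  by_contra hc
  rw [not_or] at hc
  obtain ⟨n, hn⟩ := hM.exists_nmul hc.1
  apply hc.2
  have h1 : ∀ n : ℕ, inf (nmul n (a ⊖ᵐ b)) (b ⊖ᵐ a) = zero := by
    intro n
    induction n with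
    | zero => exact le_zero (inf_le_left _ _)
    | succ n ih => exact inf_oplus_eq_zero ih (inf_ominus a b)
  have h2 := h1 n
  rw [MVAlgebra.inf_comm, inf_eq] at h2
  refine M.mem_of_le ?_ hn
  have h3 : (b ⊖ᵐ a) ⊖ᵐ ((b ⊖ᵐ a)⋆ ⊕ᵐ nmul n (a ⊖ᵐ b))⋆ = zero := by
    rw [ominus, MVAlgebra.star_star]; exact h2
  rw [ominus_eq_zero] at h3
  refine le_trans h3 (star_le_star (le_oplus_right _ _))

theorem MVQuotient.exists_nmul {A : Type u} [MVAlgebra A] {M : MVIdeal A}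
    (hM : M.IsMaximal) (x : MVQuotient M) (hx : x ≠ zero) : ∃ n : ℕ, nmul n x = one := by
  obtain ⟨a, rfl⟩ := proj_surjective M x
  obtain ⟨n, hn⟩ := hM.exists_nmul (fun h => hx ((proj_eq_zero M).2 h))
  refine ⟨n, star_inj ?_⟩
  rw [← MVHom.map_nmul, ← MVHom.map_star, (proj_eq_zero M).2 hn, MVAlgebra.star_one]

theorem MVQuotient.zero_ne_one {A : Type u} [MVAlgebra A] {M : MVIdeal A}
    (hM : M.IsMaximal) : (zero : MVQuotient M) ≠ one := by
  intro h
  apply (MVIdeal.isProper_iff M).1 hM.1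
  rw [← proj_eq_zero, MVHom.map_one, h]

namespace MVAlgebra

section Chain

variable {C : Type u} [MVAlgebra C]

theorem odot_eq_zero_iff {a b : C} : a ⊙ᵐ b = zero ↔ a ≼ b⋆ := by
  rw [← ominus_eq_zero, ominus, MVAlgebra.star_star]

theorem oplus_eq_one_iff {a b : C} : a ⊕ᵐ b = one ↔ b⋆ ≼ a := by
  rw [le, MVAlgebra.star_star, oplus_comm]

/-- If `b* ≤ a` and `b ≤ c*` then `(a ⊙ b) ⊕ c = a ⊙ (b ⊕ c)`. -/
theorem odot_oplus_of {a b c : C} (h : b⋆ ≼ a) (h' : b ≼ c⋆) :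
    (a ⊙ᵐ b) ⊕ᵐ c = a ⊙ᵐ (b ⊕ᵐ c) := by
  have ha : (a ⊙ᵐ b) ⊕ᵐ b⋆ = a := by
    have := oplus_ominus_of_le h
    rwa [ominus, MVAlgebra.star_star] at this
  have hb : a⋆ ⊕ᵐ (a ⊙ᵐ b) = b := by
    have h1 : a⋆ ≼ b := by have := star_le_star h; rwa [MVAlgebra.star_star] at this
    have := oplus_ominus_of_le h1
    rwa [ominus, MVAlgebra.star_star, odot_comm, oplus_comm] at this
  have hc : (a ⊙ᵐ b) ⊕ᵐ c ≼ a := by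
    have h1 : c ≼ b⋆ := by have := star_le_star h'; rwa [MVAlgebra.star_star] at this
    have := oplus_le_oplus_left h1 (a ⊙ᵐ b)
    rwa [ha] at this
  have e : a ⊙ᵐ (b ⊕ᵐ c) = inf a ((a ⊙ᵐ b) ⊕ᵐ c) := by
    rw [inf_eq, ← oplus_assoc, hb]
  rw [e]
  exact le_antisymm (le_inf hc (le_refl _)) (inf_le_right _ _)

/-- If `b* ≤ a` and `b* ≤ c` then `(a ⊙ b) ⊕ c = a ⊕ (b ⊙ c)`. -/
theorem odot_oplus_of' {a b c : C} (h : b⋆ ≼ a) (h' : b⋆ ≼ c) :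
    (a ⊙ᵐ b) ⊕ᵐ c = a ⊕ᵐ (b ⊙ᵐ c) := by
  have ha : (a ⊙ᵐ b) ⊕ᵐ b⋆ = a := by
    have := oplus_ominus_of_le h
    rwa [ominus, MVAlgebra.star_star] at this
  have hc : (c ⊙ᵐ b) ⊕ᵐ b⋆ = c := by
    have := oplus_ominus_of_le h'
    rwa [ominus, MVAlgebra.star_star] at this
  calc (a ⊙ᵐ b) ⊕ᵐ c = (a ⊙ᵐ b) ⊕ᵐ ((c ⊙ᵐ b) ⊕ᵐ b⋆) := by rw [hc]
    _ = ((a ⊙ᵐ b) ⊕ᵐ b⋆) ⊕ᵐ (c ⊙ᵐ b) := by rw [oplus_assoc, oplus_comm (c ⊙ᵐ b)]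
    _ = a ⊕ᵐ (b ⊙ᵐ c) := by rw [ha, odot_comm]

/-- If `a ≤ b*` and `b ≤ c*` then `(a ⊕ b) ⊙ c = a ⊙ (b ⊕ c)`. -/
theorem oplus_odot_of {a b c : C} (h : a ≼ b⋆) (h' : b ≼ c⋆) :
    (a ⊕ᵐ b) ⊙ᵐ c = a ⊙ᵐ (b ⊕ᵐ c) := by
  have h1 : (b⋆)⋆ ≼ a⋆ := star_le_star h
  have h2 : (b⋆)⋆ ≼ c⋆ := by rwa [MVAlgebra.star_star]
  have := odot_oplus_of' h1 h2
  apply star_inj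
  rw [star_odot, star_odot]
  rwa [odot, odot, MVAlgebra.star_star, MVAlgebra.star_star, MVAlgebra.star_star] at this

end Chain

end MVAlgebra

/-- Totally ordered, nontrivial MV-algebras in which every nonzero element is Archimedean. -/
class ArchChain (C : Type u) [MVAlgebra C] : Prop where
  total : ∀ x y : C, x ≼ y ∨ y ≼ x
  zero_ne_one : (zero : C) ≠ one
  arch : ∀ x : C, x ≠ zero → ∃ n : ℕ, nmul n x = one

/-- The underlying set of the ordered group of a totally ordered MV-algebra: pairs `(m, a)`
with `m` an integer and `a < 1`, thought of as `m + a`. -/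
@[ext]
structure ChainGroup (C : Type u) [MVAlgebra C] where
  int : ℤ
  frac : C
  frac_ne : frac ≠ one

namespace ChainGroup

variable {C : Type u} [MVAlgebra C]

open Classical in
/-- The carry of `a + b`. -/
noncomputable def carry (a b : C) : ℤ := if a ⊕ᵐ b = one then 1 else 0

open Classical in
/-- The fractional part of `a + b`. -/
noncomputable def rest (a b : C) : C := if a ⊕ᵐ b = one then a ⊙ᵐ b else a ⊕ᵐ b

theorem carry_pos {a b : C} (h : a ⊕ᵐ b = one) : carry a b = 1 := if_pos h

theorem carry_neg {a b : C} (h : a ⊕ᵐ b ≠ one) : carry a b = 0 := if_neg h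

theorem rest_pos {a b : C} (h : a ⊕ᵐ b = one) : rest a b = a ⊙ᵐ b := if_pos h

theorem rest_neg {a b : C} (h : a ⊕ᵐ b ≠ one) : rest a b = a ⊕ᵐ b := if_neg h

theorem rest_ne {a b : C} (ha : a ≠ one) : rest a b ≠ one := by
  unfold rest
  split_ifs with h
  · intro h1
    apply ha
    apply MVAlgebra.one_le
    rw [← h1]
    exact odot_le_left _ _
  · exact h

theorem rest_comm (a b : C) : rest a b = rest b a := by
  unfold rest
  rw [oplus_comm, odot_comm]

theorem carry_comm (a b : C) : carry a b = carry b a := by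
  unfold carry
  rw [oplus_comm]

theorem assoc_aux [ArchChain C] {a b c : C} (ha : a ≠ one) (hc : c ≠ one) :
    carry a b + carry (rest a b) c = carry b c + carry a (rest b c) ∧
      rest (rest a b) c = rest a (rest b c) := by
  have dich : ∀ {x y : C}, x ⊕ᵐ y ≠ one → x ≼ y⋆ := fun {x y} h =>
    (ArchChain.total x y⋆).resolve_right fun h' => h (oplus_eq_one_iff.2 h')
  have lt : ∀ {x y : C}, x ≠ one → x ⊙ᵐ y ≠ one := fun {x y} h h' =>
    h (one_le (by rw [← h']; exact odot_le_left _ _))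
  by_cases h1 : a ⊕ᵐ b = one <;> by_cases h2 : b ⊕ᵐ c = one
  · have e := odot_oplus_of' (oplus_eq_one_iff.1 h1)
      (oplus_eq_one_iff.1 (by rwa [oplus_comm] : c ⊕ᵐ b = one))
    rw [carry_pos h1, carry_pos h2, rest_pos h1, rest_pos h2]
    by_cases h3 : a ⊕ᵐ (b ⊙ᵐ c) = one
    · rw [carry_pos h3, rest_pos h3, carry_pos (e.trans h3), rest_pos (e.trans h3), odot_assoc]
      exact ⟨rfl, rfl⟩
    · have h4 : (a ⊙ᵐ b) ⊕ᵐ c ≠ one := by rwa [e]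
      rw [carry_neg h3, rest_neg h3, carry_neg h4, rest_neg h4, e]
      exact ⟨rfl, rfl⟩
  · have e := odot_oplus_of (oplus_eq_one_iff.1 h1) (dich h2)
    have h3 : a ⊕ᵐ (b ⊕ᵐ c) = one := by rw [← oplus_assoc, h1, one_oplus]
    have h4 : (a ⊙ᵐ b) ⊕ᵐ c ≠ one := by rw [e]; exact lt ha
    rw [carry_pos h1, carry_neg h2, rest_pos h1, rest_neg h2, carry_pos h3, carry_neg h4,
      rest_pos h3, rest_neg h4]
    exact ⟨by ring, e⟩
  · have h1' := h1
    have h2' := h2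
    rw [oplus_comm] at h1' h2'
    have e := odot_oplus_of (oplus_eq_one_iff.1 h2') (dich h1')
    have h3 : (a ⊕ᵐ b) ⊕ᵐ c = one := by rw [oplus_assoc, h2, oplus_one]
    have h4 : a ⊕ᵐ (b ⊙ᵐ c) ≠ one := by
      rw [oplus_comm, odot_comm, e]; exact lt hc
    rw [carry_neg h1, carry_pos h2, rest_neg h1, rest_pos h2, carry_pos h3, carry_neg h4,
      rest_pos h3, rest_neg h4]
    refine ⟨by ring, ?_⟩
    rw [oplus_comm a (b ⊙ᵐ c), odot_comm b c, e, odot_comm, oplus_comm a b]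
  · have e := oplus_odot_of (dich h1) (dich h2)
    rw [carry_neg h1, carry_neg h2, rest_neg h1, rest_neg h2]
    by_cases h3 : a ⊕ᵐ (b ⊕ᵐ c) = one
    · have h4 : (a ⊕ᵐ b) ⊕ᵐ c = one := by rwa [oplus_assoc]
      rw [carry_pos h3, rest_pos h3, carry_pos h4, rest_pos h4, e]
      exact ⟨rfl, rfl⟩
    · have h4 : (a ⊕ᵐ b) ⊕ᵐ c ≠ one := by rwa [oplus_assoc]
      rw [carry_neg h3, rest_neg h3, carry_neg h4, rest_neg h4, oplus_assoc]
      exact ⟨rfl, rfl⟩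

theorem inv_aux {a : C} (h0 : a ≠ zero) : a⋆ ≠ one := fun h =>
  h0 (star_inj h)

noncomputable instance [ArchChain C] : Add (ChainGroup C) :=
  ⟨fun x y => ⟨x.int + y.int + carry x.frac y.frac, rest x.frac y.frac, rest_ne x.frac_ne⟩⟩

instance [ArchChain C] : Zero (ChainGroup C) := ⟨⟨0, zero, ArchChain.zero_ne_one⟩⟩

open Classical in
noncomputable instance [ArchChain C] : Neg (ChainGroup C) :=
  ⟨fun x => if h : x.frac = zero then ⟨-x.int, zero, ArchChain.zero_ne_one⟩ else
      ⟨-x.int - 1, x.frac⋆, inv_aux h⟩⟩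

theorem add_int [ArchChain C] (x y : ChainGroup C) :
    (x + y).int = x.int + y.int + carry x.frac y.frac := rfl

theorem add_frac [ArchChain C] (x y : ChainGroup C) : (x + y).frac = rest x.frac y.frac := rfl

theorem rest_zero {a : C} (ha : a ≠ one) : rest a zero = a := by
  rw [rest, oplus_zero, if_neg ha]

theorem carry_zero {a : C} (ha : a ≠ one) : carry a zero = 0 := by
  rw [carry, oplus_zero, if_neg ha]

noncomputable instance [ArchChain C] : AddCommGroup (ChainGroup C) where
  add_assoc x y z := by
    obtain ⟨h1, h2⟩ := assoc_aux (b := y.frac) x.frac_ne z.frac_ne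
    apply ChainGroup.ext
    · simp only [add_int, add_frac]; linarith
    · exact h2
  add_comm x y := by
    apply ChainGroup.ext
    · simp only [add_int, carry_comm x.frac]; ring
    · exact rest_comm _ _
  add_zero x := by
    apply ChainGroup.ext
    · change x.int + 0 + carry x.frac zero = _
      rw [carry_zero x.frac_ne]; ring
    · exact rest_zero x.frac_ne
  zero_add x := by
    apply ChainGroup.ext
    · change 0 + x.int + carry zero x.frac = _
      rw [carry_comm, carry_zero x.frac_ne]; ring
    · change rest zero x.frac = _
      rw [rest_comm, rest_zero x.frac_ne]
  neg_add_cancel x := by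
    by_cases h : x.frac = zero
    · have e : -x = ⟨-x.int, zero, ArchChain.zero_ne_one⟩ := dif_pos h
      rw [e]
      apply ChainGroup.ext
      · change -x.int + x.int + carry zero x.frac = 0
        rw [carry_comm, carry_zero x.frac_ne]; ring
      · change rest zero x.frac = zero
        rw [rest_comm, rest_zero x.frac_ne, h]
    · have e : -x = ⟨-x.int - 1, x.frac⋆, inv_aux h⟩ := dif_neg h
      rw [e]
      have h1 := star_oplus_self x.frac
      apply ChainGroup.ext
      · change -x.int - 1 + x.int + carry x.frac⋆ x.frac = 0
        rw [carry, if_pos h1]; ring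
      · change rest x.frac⋆ x.frac = zero
        rw [rest, if_pos h1, odot_comm, odot_star_self]
  nsmul := nsmulRec
  zsmul := zsmulRec

theorem carry_nonneg (a b : C) : 0 ≤ carry a b := by
  unfold carry; split_ifs <;> norm_num

/-- The positive cone. -/
noncomputable def cone (C : Type u) [MVAlgebra C] [ArchChain C] : AddGroupCone (ChainGroup C) where
  carrier := {x | 0 ≤ x.int}
  zero_mem' := _root_.le_refl (0 : ℤ)
  add_mem' := by
    intro x y hx hy
    have := carry_nonneg x.frac y.frac
    have hx : 0 ≤ x.int := hx
    have hy : 0 ≤ y.int := hy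
    change 0 ≤ x.int + y.int + _
    linarith
  eq_zero_of_mem_of_neg_mem' := by
    intro x hx hy
    have hx : 0 ≤ x.int := hx
    have hy : 0 ≤ (-x).int := hy
    by_cases h : x.frac = zero
    · have e : -x = ⟨-x.int, zero, ArchChain.zero_ne_one⟩ := dif_pos h
      rw [e] at hy
      apply ChainGroup.ext
      · change x.int = 0
        change 0 ≤ -x.int at hy
        linarith
      · exact h
    · have e : -x = ⟨-x.int - 1, x.frac⋆, inv_aux h⟩ := dif_neg h
      rw [e] at hy
      change 0 ≤ -x.int - 1 at hy
      linarith

instance [ArchChain C] : HasMemOrNegMem (cone C) where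
  mem_or_neg_mem x := by
    by_cases h : x.frac = zero
    · have e : -x = ⟨-x.int, zero, ArchChain.zero_ne_one⟩ := dif_pos h
      rw [e]
      change 0 ≤ x.int ∨ 0 ≤ -x.int
      omega
    · have e : -x = ⟨-x.int - 1, x.frac⋆, inv_aux h⟩ := dif_neg h
      rw [e]
      change 0 ≤ x.int ∨ 0 ≤ -x.int - 1
      omega

open Classical in
noncomputable instance [ArchChain C] : LinearOrder (ChainGroup C) :=
  LinearOrder.mkOfAddGroupCone (cone C)

instance [ArchChain C] : IsOrderedAddMonoid (ChainGroup C) :=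
  IsOrderedAddMonoid.mkOfCone (cone C)

theorem nonneg_iff [ArchChain C] (x : ChainGroup C) : 0 ≤ x ↔ 0 ≤ x.int := by
  change x - 0 ∈ cone C ↔ _
  rw [sub_zero]
  rfl

/-- The image of `a < 1` in the group. -/
def ofFrac (a : C) (ha : a ≠ one) : ChainGroup C := ⟨0, a, ha⟩

/-- The order unit. -/
def unit (C : Type u) [MVAlgebra C] [ArchChain C] : ChainGroup C :=
  ⟨1, zero, ArchChain.zero_ne_one⟩

theorem int_nsmul_unit [ArchChain C] (n : ℕ) :
    n • unit C = ⟨n, zero, ArchChain.zero_ne_one⟩ := by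
  induction n with
  | zero => rw [zero_nsmul]; rfl
  | succ n ih =>
    rw [succ_nsmul, ih]
    apply ChainGroup.ext
    · change (n : ℤ) + 1 + carry zero zero = _
      rw [carry_zero ArchChain.zero_ne_one]; push_cast; ring
    · exact rest_zero ArchChain.zero_ne_one

theorem exists_unit_le [ArchChain C] (y : ChainGroup C) (hy : 0 < y) :
    ∃ n : ℕ, 1 ≤ (n • y).int := by
  have h0 : 0 ≤ y.int := (nonneg_iff y).1 hy.le
  rcases h0.lt_or_eq with h | h
  · exact ⟨1, by rw [one_nsmul]; omega⟩
  · have hf : y.frac ≠ zero := fun h1 => hy.ne' (ChainGroup.ext h.symm h1)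
    by_contra hc
    have hc : ∀ n : ℕ, (n • y).int < 1 := fun n => by
      by_contra h'; exact hc ⟨n, by omega⟩
    have key : ∀ n : ℕ, (n • y).frac = nmul n y.frac := by
      intro n
      induction n with
      | zero => rw [zero_nsmul]; rfl
      | succ n ih =>
        have h1 := hc (n + 1)
        have h2 : 0 ≤ (n • y).int := (nonneg_iff _).1 (nsmul_nonneg hy.le n)
        rw [succ_nsmul, add_int] at h1
        rw [succ_nsmul, add_frac, nmul, ← ih]
        by_cases h3 : (n • y).frac ⊕ᵐ y.frac = one
        · rw [carry, if_pos h3] at h1; omega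
        · rw [rest, if_neg h3]
    obtain ⟨n, hn⟩ := ArchChain.arch y.frac hf
    exact (n • y).frac_ne (by rw [key, hn])

instance [ArchChain C] : Archimedean (ChainGroup C) where
  arch x y hy := by
    obtain ⟨n, hn⟩ := exists_unit_le y hy
    have h1 : unit C ≤ n • y := by
      have e : n • y = unit C + ⟨(n • y).int - 1, (n • y).frac, (n • y).frac_ne⟩ := by
        apply ChainGroup.ext
        · change _ = 1 + ((n • y).int - 1) + carry zero (n • y).frac
          rw [carry_comm, carry_zero (n • y).frac_ne]; ring
        · change _ = rest zero (n • y).frac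
          rw [rest_comm, rest_zero (n • y).frac_ne]
      rw [e]
      apply le_add_of_nonneg_right
      rw [nonneg_iff]
      change 0 ≤ (n • y).int - 1
      omega
    have h2 : x ≤ (x.int + 1).toNat • unit C := by
      rw [← sub_nonneg]
      have e : (x.int + 1).toNat • unit C - x =
          ⟨((x.int + 1).toNat : ℤ), zero, ArchChain.zero_ne_one⟩ + -x := by
        rw [int_nsmul_unit, sub_eq_add_neg]
      rw [e, nonneg_iff, add_int]
      have hx : -x.int - 1 ≤ (-x).int := by
        by_cases h : x.frac = zero
        · have e : -x = ⟨-x.int, zero, ArchChain.zero_ne_one⟩ := dif_pos h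
          rw [e]; change _ ≤ -x.int; omega
        · have e : -x = ⟨-x.int - 1, x.frac⋆, inv_aux h⟩ := dif_neg h
          rw [e]
      have := carry_nonneg (zero : C) (-x).frac
      change 0 ≤ ((x.int + 1).toNat : ℤ) + (-x).int + carry zero (-x).frac
      omega
    refine ⟨(x.int + 1).toNat * n, h2.trans ?_⟩
    rw [mul_nsmul']
    exact nsmul_le_nsmul_right h1 _

end ChainGroup

/-- An Archimedean MV-chain embeds into `[0, 1]`. -/
theorem ArchChain.exists_hom (C : Type u) [MVAlgebra C] [ArchChain C] :
    ∃ f : MVHom C unitInterval, ∀ a, f a = zero → a = zero := by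
  classical
  obtain ⟨φ, hφ⟩ := Archimedean.exists_orderAddMonoidHom_real_injective (ChainGroup C)
  have hmono : Monotone φ := φ.monotone'
  have hu0 : (0 : ChainGroup C) < ChainGroup.unit C := by
    refine lt_of_le_of_ne ((ChainGroup.nonneg_iff _).2 (zero_le_one (α := ℤ))) ?_
    intro h
    exact _root_.zero_ne_one (α := ℤ) (congrArg ChainGroup.int h)
  have hu : 0 < φ (ChainGroup.unit C) := by
    rw [← map_zero φ]
    exact (hmono.strictMono_of_injective hφ) hu0
  -- the value of `a`, for `a < 1`
  let v : C → ℝ := fun a => if h : a = one then 1 else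
    φ (ChainGroup.ofFrac a h) / φ (ChainGroup.unit C)
  have v1 : v one = 1 := dif_pos rfl
  have hv : ∀ a (h : a ≠ one), v a = φ (ChainGroup.ofFrac a h) / φ (ChainGroup.unit C) :=
    fun a h => dif_neg h
  have v0 : v zero = 0 := by
    rw [hv _ ArchChain.zero_ne_one]
    have : ChainGroup.ofFrac (zero : C) ArchChain.zero_ne_one = 0 := rfl
    rw [this, map_zero, zero_div]
  have vnn : ∀ a, 0 ≤ v a := by
    intro a
    by_cases h : a = one
    · rw [h, v1]; exact zero_le_one
    · rw [hv a h]
      refine div_nonneg ?_ hu.le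
      rw [← map_zero φ]
      exact hmono ((ChainGroup.nonneg_iff _).2 (_root_.le_refl (0 : ℤ)))
  have vadd : ∀ a b, a ≠ one → b ≠ one →
      (a ⊕ᵐ b = one → v a + v b = 1 + v (a ⊙ᵐ b)) ∧ (a ⊕ᵐ b ≠ one → v a + v b = v (a ⊕ᵐ b)) := by
    intro a b ha hb
    constructor
    · intro h
      have hab : a ⊙ᵐ b ≠ one := fun h' => ha (one_le (by rw [← h']; exact odot_le_left _ _))
      have e : ChainGroup.ofFrac a ha + ChainGroup.ofFrac b hb =
          ChainGroup.unit C + ChainGroup.ofFrac (a ⊙ᵐ b) hab := by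
        apply ChainGroup.ext
        · change 0 + 0 + ChainGroup.carry a b = 1 + 0 + ChainGroup.carry zero (a ⊙ᵐ b)
          rw [ChainGroup.carry_comm zero, ChainGroup.carry_zero hab, ChainGroup.carry, if_pos h]
          rfl
        · change ChainGroup.rest a b = ChainGroup.rest zero (a ⊙ᵐ b)
          rw [ChainGroup.rest_comm zero, ChainGroup.rest_zero hab, ChainGroup.rest, if_pos h]
      have e' := congrArg φ e
      rw [map_add, map_add] at e'
      rw [hv a ha, hv b hb, hv _ hab, ← add_div, e', add_div, div_self hu.ne']
    · intro h
      have e : ChainGroup.ofFrac a ha + ChainGroup.ofFrac b hb =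
          ChainGroup.ofFrac (a ⊕ᵐ b) h := by
        apply ChainGroup.ext
        · change 0 + 0 + ChainGroup.carry a b = 0
          rw [ChainGroup.carry, if_neg h]
          rfl
        · change ChainGroup.rest a b = a ⊕ᵐ b
          rw [ChainGroup.rest, if_neg h]
      have e' := congrArg φ e
      rw [map_add] at e'
      rw [hv a ha, hv b hb, hv _ h, ← add_div, e']
  have vstar : ∀ a, v a⋆ = 1 - v a := by
    intro a
    by_cases h : a = one
    · rw [h, MVAlgebra.star_one, v0, v1, sub_self]
    · by_cases h0 : a = zero
      · rw [h0, MVAlgebra.star_zero, v0, v1, sub_zero]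
      · have := (vadd a a⋆ h (ChainGroup.inv_aux h0)).1 (oplus_star_self a)
        rw [odot_star_self, v0] at this
        linarith
  have vle : ∀ a, v a ≤ 1 := by
    intro a
    have := vnn a⋆
    rw [vstar] at this
    linarith
  refine ⟨⟨fun a => ⟨v a, vnn a, vle a⟩, ?_, ?_, Subtype.ext v0⟩, ?_⟩
  · intro a b
    apply Subtype.ext
    rw [coe_oplus]
    change v (a ⊕ᵐ b) = min 1 (v a + v b)
    by_cases ha : a = one
    · rw [ha, one_oplus, v1, min_eq_left]
      linarith [vnn b]
    by_cases hb : b = one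
    · rw [hb, oplus_one, v1, min_eq_left]
      linarith [vnn a]
    by_cases h : a ⊕ᵐ b = one
    · rw [(vadd a b ha hb).1 h, h, v1, min_eq_left]
      linarith [vnn (a ⊙ᵐ b)]
    · rw [(vadd a b ha hb).2 h, min_eq_right (vle _)]
  · intro a
    apply Subtype.ext
    rw [coe_star]
    exact vstar a
  · intro a ha
    have h : v a = 0 := congrArg Subtype.val ha
    by_contra hc
    have h1 : a ≠ one := fun h' => by rw [h', v1] at h; exact one_ne_zero h
    rw [hv a h1, div_eq_zero_iff, or_iff_left hu.ne', map_eq_zero_iff φ hφ] at h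
    exact hc (congrArg ChainGroup.frac h)

/-- For a maximal ideal `M` there is an embedding `A / M → [0, 1]` (it is unique by
`MVHom.eq_of_ker_eq`). -/
theorem MVIdeal.IsMaximal.exists_hom {A : Type u} [MVAlgebra A] {M : MVIdeal A}
    (hM : M.IsMaximal) : ∃ f : MVHom (MVQuotient M) unitInterval, Function.Injective f := by
  have : ArchChain (MVQuotient M) :=
    ⟨MVQuotient.le_total hM, MVQuotient.zero_ne_one hM, MVQuotient.exists_nmul hM⟩
  obtain ⟨f, hf⟩ := ArchChain.exists_hom (MVQuotient M)
  refine ⟨f, fun x y h => ?_⟩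
  have e : ∀ x y, f x = f y → x ≼ y := by
    intro x y h
    rw [← ominus_eq_zero]
    apply hf
    rw [MVHom.map_ominus, h, ominus_eq_zero]
    exact le_refl _
  exact le_antisymm (e x y h) (e y x h.symm)

namespace MaxSpec

variable {A : Type u} {B : Type v} [MVAlgebra A] [MVAlgebra B]

/-- The unique embedding `ι_M : A / M → [0, 1]` for a maximal ideal `M`. -/
noncomputable def embed (M : MaxSpec A) : MVHom (MVQuotient M.1) unitInterval :=
  Classical.choose M.2.exists_hom

theorem embed_injective (M : MaxSpec A) : Function.Injective (embed M) :=
  Classical.choose_spec M.2.exists_hom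

/-- The homomorphism `ι : A → [0, 1]^(Max A)`, `a ↦ â`, where `â(M) = ι_M(a / M)`. -/
noncomputable def hat (A : Type u) [MVAlgebra A] : MVHom A (MaxSpec A → unitInterval) where
  toFun a M := embed M (MVQuotient.proj M.1 a)
  map_oplus a b := by funext M; rw [MVHom.map_oplus, MVHom.map_oplus]; rfl
  map_star a := by funext M; rw [MVHom.map_star, MVHom.map_star]; rfl
  map_zero := by funext M; rw [MVHom.map_zero, MVHom.map_zero]; rfl

theorem hat_eq_zero (a : A) (M : MaxSpec A) : hat A a M = zero ↔ a ∈ M.1 := by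
  rw [← MVQuotient.proj_eq_zero]
  change embed M _ = zero ↔ _
  rw [← (embed M).map_zero]
  exact (embed_injective M).eq_iff

/-- Any homomorphism to `[0, 1]` with kernel `M` is evaluation at `M`. -/
theorem hat_eq (f : MVHom A unitInterval) (M : MaxSpec A) (h : f.ker = M.1) (a : A) :
    hat A a M = f a := by
  have : (embed M).comp (MVQuotient.proj M.1) = f := by
    apply MVHom.eq_of_ker_eq
    rw [h]
    ext a
    exact hat_eq_zero a M
  rw [← this]; rfl

/-- Evaluation at a point, as a homomorphism. -/
def evalHom {X : Type u} (x : X) : MVHom (X → unitInterval) unitInterval :=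
  ⟨fun o => o x, fun _ _ => rfl, fun _ => rfl, rfl⟩

/-- `Max h (N) = h⁻¹[N]`. -/
def comap (h : MVHom A B) (N : MaxSpec B) : MaxSpec A :=
  ⟨{ carrier := {a | h a ∈ N.1}
     zero_mem := by change h _ ∈ N.1; rw [h.map_zero]; exact N.1.zero_mem
     oplus_mem := fun {a b} ha hb => by
      change h _ ∈ N.1; rw [h.map_oplus]; exact N.1.oplus_mem ha hb
     mem_of_le := fun {a b} hab hb => N.1.mem_of_le (h.map_le hab) hb }, by
    convert MVHom.ker_isMaximal (((evalHom N).comp (hat B)).comp h) using 1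
    ext a
    exact (hat_eq_zero (h a) N).symm⟩

theorem hat_comap (h : MVHom A B) (N : MaxSpec B) (a : A) :
    hat A a (comap h N) = hat B (h a) N :=
  hat_eq (((evalHom N).comp (hat B)).comp h) (comap h N)
    (by ext a; exact hat_eq_zero (h a) N) a

end MaxSpec

/-- An MV-topological space `⟨X, Ω⟩`. -/
structure MVTopCat : Type (u + 1) where
  carrier : Type u
  opens : Set (carrier → unitInterval)
  zero_mem : zero ∈ opens
  one_mem : one ∈ opens
  sSup_mem : ∀ G : Set (carrier → unitInterval), G ⊆ opens → sSup G ∈ opens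
  odot_mem : ∀ o₁ ∈ opens, ∀ o₂ ∈ opens, o₁ ⊙ᵐ o₂ ∈ opens
  oplus_mem : ∀ o₁ ∈ opens, ∀ o₂ ∈ opens, o₁ ⊕ᵐ o₂ ∈ opens
  inf_mem : ∀ o₁ ∈ opens, ∀ o₂ ∈ opens, o₁ ⊓ o₂ ∈ opens

namespace MVTopCat

/-- The closed MV-subsets `Ξ = {o* | o ∈ Ω}`. -/
def closeds (τ : MVTopCat.{u}) : Set (τ.carrier → unitInterval) := {c | ∃ o ∈ τ.opens, c = o⋆}

/-- MV-continuous maps: preimages `o ∘ f` of open MV-subsets are open. -/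
@[ext]
structure Hom (τ τ' : MVTopCat.{u}) where
  toFun : τ.carrier → τ'.carrier
  continuous : ∀ o ∈ τ'.opens, o ∘ toFun ∈ τ.opens

instance : CategoryTheory.Category MVTopCat.{u} where
  Hom τ τ' := Hom τ τ'
  id τ := ⟨fun x => x, fun _ h => h⟩
  comp f g := ⟨fun x => g.toFun (f.toFun x), fun o h => f.continuous _ (g.continuous o h)⟩

/-- `Θ` is a base if it consists of open sets and every open set is a join of elements of `Θ`. -/
def IsBase (τ : MVTopCat.{u}) (Θ : Set (τ.carrier → unitInterval)) : Prop :=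
  Θ ⊆ τ.opens ∧ ∀ o ∈ τ.opens, ∃ G ⊆ Θ, o = sSup G

/-- Every open covering contains an additive covering, that is, a finite family (repetitions
allowed) of its members whose sum is `1`. -/
def IsCompact (τ : MVTopCat.{u}) : Prop :=
  ∀ Γ ⊆ τ.opens, sSup Γ = one →
    ∃ l : List (τ.carrier → unitInterval), (∀ o ∈ l, o ∈ Γ) ∧ l.foldr oplus zero = one

/-- The Hausdorff (separation) property. -/
def IsSeparated (τ : MVTopCat.{u}) : Prop :=
  ∀ x y : τ.carrier, x ≠ y → ∃ o₁ ∈ τ.opens, ∃ o₂ ∈ τ.opens,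
    o₁ x = 1 ∧ o₂ y = 1 ∧ o₁ ⊓ o₂ = zero

/-- There is a base of clopen sets. -/
def IsZeroDimensional (τ : MVTopCat.{u}) : Prop :=
  ∃ Θ : Set (τ.carrier → unitInterval), Θ ⊆ τ.opens ∩ τ.closeds ∧ τ.IsBase Θ

/-- Stone MV-spaces. -/
def IsStone (τ : MVTopCat.{u}) : Prop :=
  τ.IsCompact ∧ τ.IsSeparated ∧ τ.IsZeroDimensional

/-- Crisp topologies: all open sets are `{0, 1}`-valued. -/
def IsCrisp (τ : MVTopCat.{u}) : Prop := ∀ o ∈ τ.opens, ∀ x, o x = 0 ∨ o x = 1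

/-- The algebra `Clop τ = Ω ∩ Ξ` of clopen MV-subsets. -/
def Clop (τ : MVTopCat.{u}) : Type u := {o : τ.carrier → unitInterval // o ∈ τ.opens ∩ τ.closeds}

theorem mem_closeds {τ : MVTopCat.{u}} {c : τ.carrier → unitInterval} :
    c ∈ τ.closeds ↔ c⋆ ∈ τ.opens := by
  constructor
  · rintro ⟨o, ho, rfl⟩; rwa [MVAlgebra.star_star]
  · intro h; exact ⟨c⋆, h, (MVAlgebra.star_star c).symm⟩

noncomputable instance (τ : MVTopCat.{u}) : MVAlgebra (Clop τ) where
  oplus a b := ⟨a.1 ⊕ᵐ b.1, τ.oplus_mem _ a.2.1 _ b.2.1, mem_closeds.2 (by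
    have := τ.odot_mem _ (mem_closeds.1 a.2.2) _ (mem_closeds.1 b.2.2)
    rwa [odot, MVAlgebra.star_star, MVAlgebra.star_star] at this)⟩
  star a := ⟨a.1⋆, mem_closeds.1 a.2.2, mem_closeds.2 (by
    rw [MVAlgebra.star_star]; exact a.2.1)⟩
  zero := ⟨zero, τ.zero_mem, mem_closeds.2 τ.one_mem⟩
  oplus_assoc _ _ _ := Subtype.ext (oplus_assoc _ _ _)
  oplus_comm _ _ := Subtype.ext (oplus_comm _ _)
  oplus_zero _ := Subtype.ext (oplus_zero _)
  star_star _ := Subtype.ext (MVAlgebra.star_star _)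
  oplus_star_zero _ := Subtype.ext (oplus_star_zero _)
  lukasiewicz _ _ := Subtype.ext (lukasiewicz _ _)

section Base

variable {X : Type u} (Θ : Set (X → unitInterval))

theorem exists_sSup_iff (h0 : zero ∈ Θ) (o : X → unitInterval) :
    (∃ G ⊆ Θ, o = sSup G) ↔
      ∀ x, ∀ ε : ℝ, 0 < ε → ∃ t ∈ Θ, t ≤ o ∧ (o x : ℝ) - ε < t x := by
  constructor
  · rintro ⟨G, hG, rfl⟩ x ε hε
    rcases G.eq_empty_or_nonempty with rfl | hne
    · refine ⟨zero, h0, ?_, ?_⟩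
      · intro y; exact Subtype.coe_le_coe.1 (sSup (∅ : Set (X → unitInterval)) y).2.1
      · rw [sSup_empty]
        change (0 : ℝ) - ε < 0
        linarith
    · by_contra hc
      push Not at hc
      have h1 : ∀ t ∈ G, (t x : ℝ) ≤ (sSup G x : ℝ) - ε := fun t ht => hc t (hG ht) (le_sSup ht)
      obtain ⟨t₀, ht₀⟩ := hne
      have hnn : 0 ≤ (sSup G x : ℝ) - ε := (t₀ x).2.1.trans (h1 t₀ ht₀)
      have hle1 : (sSup G x : ℝ) ≤ 1 := (sSup G x).2.2
      obtain ⟨c, hc⟩ : ∃ c : unitInterval, (c : ℝ) = (sSup G x : ℝ) - ε :=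
        ⟨⟨(sSup G x : ℝ) - ε, hnn, by linarith⟩, rfl⟩
      have h2 : sSup G x ≤ c := by
        rw [sSup_apply]
        refine iSup_le ?_
        rintro ⟨t, ht⟩
        exact Subtype.coe_le_coe.1 ((h1 t ht).trans hc.ge)
      have h3 := Subtype.coe_le_coe.2 h2
      linarith
  · intro h
    refine ⟨{t | t ∈ Θ ∧ t ≤ o}, fun t ht => ht.1, ?_⟩
    refine _root_.le_antisymm (fun x => ?_) (sSup_le fun t ht => ht.2)
    rw [← Subtype.coe_le_coe]
    refine le_of_forall_pos_le_add fun ε hε => ?_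
    obtain ⟨t, ht, hto, hx⟩ := h x ε hε
    have h1 : t ≤ sSup {t | t ∈ Θ ∧ t ≤ o} := le_sSup ⟨ht, hto⟩
    have h2 := Subtype.coe_le_coe.2 (h1 x)
    linarith

/-- The MV-topology whose open sets are the joins of elements of `Θ`, for a family `Θ` that
contains `0` and `1` and is closed under `⊕`, `⊙` and `∧`. -/
noncomputable def ofBase (h0 : zero ∈ Θ) (h1 : one ∈ Θ)
    (hoplus : ∀ s ∈ Θ, ∀ t ∈ Θ, s ⊕ᵐ t ∈ Θ) (hodot : ∀ s ∈ Θ, ∀ t ∈ Θ, s ⊙ᵐ t ∈ Θ)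
    (hinf : ∀ s ∈ Θ, ∀ t ∈ Θ, s ⊓ t ∈ Θ) : MVTopCat.{u} where
  carrier := X
  opens := {o | ∃ G ⊆ Θ, o = sSup G}
  zero_mem := ⟨{zero}, by simpa using h0, by simp⟩
  one_mem := ⟨{one}, by simpa using h1, by simp⟩
  sSup_mem G hG := by
    refine ⟨{t | t ∈ Θ ∧ t ≤ sSup G}, fun t ht => ht.1, ?_⟩
    refine _root_.le_antisymm (sSup_le fun o ho => ?_) (sSup_le fun t ht => ht.2)
    obtain ⟨G', hG', rfl⟩ := hG ho
    exact sSup_le fun t ht => le_sSup ⟨hG' ht, (le_sSup ht).trans (le_sSup ho)⟩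
  odot_mem o₁ ho₁ o₂ ho₂ := by
    rw [Set.mem_ofPred_eq, exists_sSup_iff Θ h0] at *
    intro x ε hε
    obtain ⟨t₁, ht₁, hle₁, hx₁⟩ := ho₁ x (ε / 2) (by linarith)
    obtain ⟨t₂, ht₂, hle₂, hx₂⟩ := ho₂ x (ε / 2) (by linarith)
    refine ⟨_, hodot t₁ ht₁ t₂ ht₂, fun y => ?_, ?_⟩
    · have i1 := Subtype.coe_le_coe.2 (hle₁ y)
      have i2 := Subtype.coe_le_coe.2 (hle₂ y)
      rw [← Subtype.coe_le_coe]
      change ((t₁ y ⊙ᵐ t₂ y : unitInterval) : ℝ) ≤ (o₁ y ⊙ᵐ o₂ y : unitInterval)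
      rw [coe_odot, coe_odot]
      exact max_le_max_left _ (by linarith)
    · change ((o₁ x ⊙ᵐ o₂ x : unitInterval) : ℝ) - ε < (t₁ x ⊙ᵐ t₂ x : unitInterval)
      rw [coe_odot, coe_odot, max_def, max_def]
      split_ifs <;> linarith
  oplus_mem o₁ ho₁ o₂ ho₂ := by
    rw [Set.mem_ofPred_eq, exists_sSup_iff Θ h0] at *
    intro x ε hε
    obtain ⟨t₁, ht₁, hle₁, hx₁⟩ := ho₁ x (ε / 2) (by linarith)
    obtain ⟨t₂, ht₂, hle₂, hx₂⟩ := ho₂ x (ε / 2) (by linarith)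
    refine ⟨_, hoplus t₁ ht₁ t₂ ht₂, fun y => ?_, ?_⟩
    · have i1 := Subtype.coe_le_coe.2 (hle₁ y)
      have i2 := Subtype.coe_le_coe.2 (hle₂ y)
      rw [← Subtype.coe_le_coe]
      change ((t₁ y ⊕ᵐ t₂ y : unitInterval) : ℝ) ≤ (o₁ y ⊕ᵐ o₂ y : unitInterval)
      rw [coe_oplus, coe_oplus]
      exact min_le_min_left _ (by linarith)
    · change ((o₁ x ⊕ᵐ o₂ x : unitInterval) : ℝ) - ε < (t₁ x ⊕ᵐ t₂ x : unitInterval)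
      rw [coe_oplus, coe_oplus, min_def, min_def]
      split_ifs <;> linarith
  inf_mem o₁ ho₁ o₂ ho₂ := by
    rw [Set.mem_ofPred_eq, exists_sSup_iff Θ h0] at *
    intro x ε hε
    obtain ⟨t₁, ht₁, hle₁, hx₁⟩ := ho₁ x ε hε
    obtain ⟨t₂, ht₂, hle₂, hx₂⟩ := ho₂ x ε hε
    refine ⟨_, hinf t₁ ht₁ t₂ ht₂, inf_le_inf hle₁ hle₂, ?_⟩
    have e : ∀ a b : unitInterval, ((a ⊓ b : unitInterval) : ℝ) = min (a : ℝ) b := fun a b => by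
      rcases _root_.le_total a b with h | h
      · rw [inf_eq_left.2 h, min_eq_left (Subtype.coe_le_coe.2 h)]
      · rw [inf_eq_right.2 h, min_eq_right (Subtype.coe_le_coe.2 h)]
    rw [Pi.inf_apply, Pi.inf_apply, e, e, min_def, min_def]
    split_ifs <;> linarith

end Base

end MVTopCat

theorem MVAlgebra.inf_eq_inf {X : Type u} (f g : X → unitInterval) : inf f g = f ⊓ g := by
  funext x
  apply Subtype.ext
  change ((inf (f x) (g x) : unitInterval) : ℝ) = _
  rw [coe_inf, Pi.inf_apply]
  rcases _root_.le_total (f x) (g x) with h | h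
  · rw [inf_eq_left.2 h, min_eq_left (Subtype.coe_le_coe.2 h)]
  · rw [inf_eq_right.2 h, min_eq_right (Subtype.coe_le_coe.2 h)]

/-- The MV-topological space `⟨Max A, Ω_A⟩` with base `{â | a ∈ A}`. -/
noncomputable def MaxSpec.space (A : Type u) [MVAlgebra A] : MVTopCat.{u} :=
  MVTopCat.ofBase (Set.range (hat A)) ⟨zero, (hat A).map_zero⟩ ⟨one, (hat A).map_one⟩
    (by rintro _ ⟨a, rfl⟩ _ ⟨b, rfl⟩; exact ⟨a ⊕ᵐ b, (hat A).map_oplus a b⟩)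
    (by rintro _ ⟨a, rfl⟩ _ ⟨b, rfl⟩; exact ⟨a ⊙ᵐ b, (hat A).map_odot a b⟩)
    (by
      rintro _ ⟨a, rfl⟩ _ ⟨b, rfl⟩
      exact ⟨inf a b, by rw [(hat A).map_inf, inf_eq_inf]⟩)

/-- The category of MV-algebras. -/
structure MVAlgCat : Type (u + 1) where
  carrier : Type u
  [str : MVAlgebra carrier]

attribute [instance] MVAlgCat.str

instance : CategoryTheory.Category MVAlgCat.{u} where
  Hom A B := MVHom A.carrier B.carrier
  id A := MVHom.id A.carrier
  comp f g := g.comp f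


theorem sSup_comp {X Y : Type u} (G : Set (Y → unitInterval)) (f : X → Y) :
    sSup G ∘ f = sSup ((fun t => t ∘ f) '' G) := by
  funext x
  rw [Function.comp_apply, sSup_apply, sSup_apply]
  apply _root_.le_antisymm
  · refine iSup_le fun t => ?_
    exact le_iSup (fun s : ((fun t => t ∘ f) '' G : Set _) => s.1 x) ⟨t.1 ∘ f, t.1, t.2, rfl⟩
  · refine iSup_le ?_
    rintro ⟨_, t, ht, rfl⟩
    exact le_iSup (fun s : G => s.1 (f x)) ⟨t, ht⟩

theorem MaxSpec.isOpen_comap {A : Type u} {B : Type u} [MVAlgebra A] [MVAlgebra B] (h : MVHom A B)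
    (o : MaxSpec A → unitInterval) (ho : o ∈ (space A).opens) :
    o ∘ comap h ∈ (space B).opens := by
  obtain ⟨G, hG, rfl⟩ := ho
  refine ⟨_, ?_, sSup_comp G (comap h)⟩
  rintro _ ⟨t, ht, rfl⟩
  obtain ⟨a, rfl⟩ := hG ht
  exact ⟨h a, funext fun N => (hat_comap h N a).symm⟩

/-- The contravariant functor `Clop`, acting on morphisms by `o ↦ o ∘ f`. -/
noncomputable def mvClop : MVTopCat.{u}ᵒᵖ ⥤ MVAlgCat.{u} where
  obj τ := ⟨MVTopCat.Clop τ.unop⟩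
  map {τ τ'} f :=
    { toFun := fun o => ⟨o.1 ∘ f.unop.toFun, f.unop.continuous _ o.2.1,
        MVTopCat.mem_closeds.2 (f.unop.continuous _ (MVTopCat.mem_closeds.1 o.2.2))⟩
      map_oplus := fun _ _ => rfl
      map_star := fun _ => rfl
      map_zero := rfl }

/-- The contravariant functor `Max`, acting on morphisms by `N ↦ h⁻¹[N]`. -/
noncomputable def mvMax : MVAlgCat.{u}ᵒᵖ ⥤ MVTopCat.{u} where
  obj A := MaxSpec.space A.unop.carrier
  map h := ⟨MaxSpec.comap h.unop, MaxSpec.isOpen_comap h.unop⟩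

theorem MVTopCat.ker_evalClop (τ : MVTopCat.{u}) (x : τ.carrier) :
    MVIdeal.IsMaximal (A := Clop τ)
      (MVHom.ker ⟨fun o : Clop τ => o.1 x, fun _ _ => rfl, fun _ => rfl, rfl⟩) :=
  MVHom.ker_isMaximal _

/-- The map `τ → Max (Clop τ)`, `x ↦ {o ∈ Clop τ | o(x) = 0}`. -/
def MVTopCat.point (τ : MVTopCat.{u}) (x : τ.carrier) : MaxSpec (Clop τ) :=
  ⟨{ carrier := {o | o.1 x = 0}
     zero_mem := (MVHom.ker ⟨fun o : Clop τ => o.1 x, fun _ _ => rfl, fun _ => rfl, rfl⟩).zero_mem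
     oplus_mem :=
      (MVHom.ker ⟨fun o : Clop τ => o.1 x, fun _ _ => rfl, fun _ => rfl, rfl⟩).oplus_mem
     mem_of_le :=
      (MVHom.ker ⟨fun o : Clop τ => o.1 x, fun _ _ => rfl, fun _ => rfl, rfl⟩).mem_of_le },
    τ.ker_evalClop x⟩

theorem MVTopCat.hat_point (τ : MVTopCat.{u}) (o : Clop τ) (x : τ.carrier) :
    MaxSpec.hat (Clop τ) o (τ.point x) = o.1 x :=
  MaxSpec.hat_eq ⟨fun o : Clop τ => o.1 x, fun _ _ => rfl, fun _ => rfl, rfl⟩ (τ.point x) rfl o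

theorem MVTopCat.isOpen_point (τ : MVTopCat.{u}) (o : MaxSpec (Clop τ) → unitInterval)
    (ho : o ∈ (MaxSpec.space (Clop τ)).opens) : o ∘ τ.point ∈ τ.opens := by
  obtain ⟨G, hG, rfl⟩ := ho
  rw [sSup_comp]
  apply τ.sSup_mem
  rintro _ ⟨t, ht, rfl⟩
  obtain ⟨a, rfl⟩ := hG ht
  have : MaxSpec.hat (MVTopCat.Clop τ) a ∘ τ.point = a.1 := funext fun x => τ.hat_point a x
  change MaxSpec.hat (MVTopCat.Clop τ) a ∘ τ.point ∈ τ.opens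
  rw [this]
  exact a.2.1

/-- The natural map `τ → Max (Clop τ)`, `x ↦ {o ∈ Clop τ | o(x) = 0}`. -/
noncomputable def mvUnit : 𝟭 MVTopCat.{u} ⟶ mvClop.rightOp ⋙ mvMax where
  app τ :=
    { toFun := τ.point
      continuous := τ.isOpen_point }
  naturality _ _ _ := rfl

/-- The natural map `A → Clop (Max A)`, `a ↦ â`. -/
noncomputable def mvCounit : 𝟭 MVAlgCat.{u} ⟶ mvMax.rightOp ⋙ mvClop where
  app A :=
    { toFun := fun a => ⟨MaxSpec.hat A.carrier a,
        ⟨{MaxSpec.hat A.carrier a}, by simp, by simp⟩,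
        MVTopCat.mem_closeds.2 ⟨{MaxSpec.hat A.carrier a⋆}, by simp, by
          rw [sSup_singleton, MVHom.map_star]; rfl⟩⟩
      map_oplus := fun a b => Subtype.ext ((MaxSpec.hat A.carrier).map_oplus a b)
      map_star := fun a => Subtype.ext ((MaxSpec.hat A.carrier).map_star a)
      map_zero := Subtype.ext (MaxSpec.hat A.carrier).map_zero }
  naturality A B h := by
    apply MVHom.ext
    funext a
    apply Subtype.ext
    funext N
    exact (MaxSpec.hat_comap h N a).symm

namespace MVAlgebra

/-- The set `uX` of upper bounds of `X`. -/
def upper {A : Type u} [MVAlgebra A] (X : Set A) : Set A := {b | ∀ a ∈ X, a ≼ b}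

/-- The set `lX` of lower bounds of `X`. -/
def lower {A : Type u} [MVAlgebra A] (X : Set A) : Set A := {b | ∀ a ∈ X, b ≼ a}

/-- A cut is a set `X` with `X = luX`. -/
def IsCut {A : Type u} [MVAlgebra A] (X : Set A) : Prop := X = lower (upper X)

/-- A limit cut: the pointwise infimum of the fuzzy sets `b̂ ⊖ â`, for `a ∈ X` and `b ∈ uX`,
is `0`. -/
def IsLimitCut {A : Type u} [MVAlgebra A] (X : Set A) : Prop :=
  IsCut X ∧ sInf {d : MaxSpec A → unitInterval |
    ∃ a ∈ X, ∃ b ∈ upper X, d = MaxSpec.hat A b ⊖ᵐ MaxSpec.hat A a} = zero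

/-- Simple MV-algebras: `{0}` is the only proper ideal. -/
def IsSimple (A : Type u) [MVAlgebra A] : Prop :=
  ∀ I : MVIdeal A, I.IsProper ↔ I.carrier = {zero}

/-- Semisimple MV-algebras: subdirect products of simple MV-algebras. -/
def IsSemisimple (A : Type u) [MVAlgebra A] : Prop :=
  ∃ (ι : Type u) (S : ι → MVAlgCat.{u}), (∀ i, IsSimple (S i).carrier) ∧
    ∃ f : MVHom A (∀ i, (S i).carrier),
      Function.Injective f ∧ ∀ i, Function.Surjective fun a => f a i

/-- Limit cut complete MV-algebras: semisimple, and every limit cut has a supremum. -/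
def IsLCC (A : Type u) [MVAlgebra A] : Prop :=
  IsSemisimple A ∧ ∀ X : Set A, IsLimitCut X → ∃ s ∈ upper X, ∀ b ∈ upper X, s ≼ b

/-- A Boolean algebra as an MV-algebra: `⊕` is the join and `*` is the complement. -/
@[reducible]
def ofBooleanAlgebra (B : Type u) [BooleanAlgebra B] : MVAlgebra B where
  oplus a b := a ⊔ b
  star a := aᶜ
  zero := ⊥
  oplus_assoc := sup_assoc
  oplus_comm := _root_.sup_comm
  oplus_zero := sup_bot_eq
  star_star := compl_compl
  oplus_star_zero a := by simp
  lukasiewicz a b := by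
    simp only [compl_sup, compl_compl]
    rw [sup_inf_right, sup_inf_right, compl_sup_eq_top, compl_sup_eq_top, inf_top_eq, inf_top_eq,
      _root_.sup_comm]

end MVAlgebra

/-- The inclusion of the category of Boolean algebras into that of MV-algebras. -/
def boolToMV : BoolAlg.{u} ⥤ MVAlgCat.{u} where
  obj B := @MVAlgCat.mk B (ofBooleanAlgebra B)
  map {B B'} f :=
    letI := ofBooleanAlgebra B
    letI := ofBooleanAlgebra B'
    { toFun := fun b => f.hom b
      map_oplus := fun a b => map_sup f.hom a b
      map_star := fun a => map_compl' f.hom a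
      map_zero := map_bot f.hom }

theorem MVTopCat.indicator_eq {X : Type u} (U : Set X) (x : X) :
    (x ∈ U ∧ U.indicator (fun _ => (1 : unitInterval)) x = 1) ∨
      (x ∉ U ∧ U.indicator (fun _ => (1 : unitInterval)) x = 0) := by
  by_cases h : x ∈ U
  · exact Or.inl ⟨h, Set.indicator_of_mem h _⟩
  · exact Or.inr ⟨h, Set.indicator_of_notMem h _⟩

/-- A topological space as a (crisp) MV-topological space: the open MV-subsets are the
characteristic functions of the open sets. -/
noncomputable def crispSpace (X : Type u) [TopologicalSpace X] : MVTopCat.{u} where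
  carrier := X
  opens := {o | ∃ U : Set X, IsOpen U ∧ o = U.indicator fun _ => (1 : unitInterval)}
  zero_mem := ⟨∅, isOpen_empty, by rw [Set.indicator_empty]; rfl⟩
  one_mem := ⟨Set.univ, isOpen_univ, by
    rw [Set.indicator_univ]; funext x; exact Subtype.ext coe_one⟩
  sSup_mem G hG := by
    refine ⟨{x | ∃ o ∈ G, o x = 1}, ?_, ?_⟩
    · have e : {x | ∃ o ∈ G, o x = 1} = ⋃ o ∈ G, {x : X | o x = 1} := by ext x; simp
      rw [e]
      refine isOpen_biUnion fun o ho => ?_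
      obtain ⟨U, hU, rfl⟩ := hG ho
      convert hU using 1
      ext x
      rcases MVTopCat.indicator_eq U x with ⟨h, h'⟩ | ⟨h, h'⟩
      · exact ⟨fun _ => h, fun _ => h'⟩
      · exact ⟨fun h1 => absurd (h'.symm.trans h1) zero_ne_one, fun h1 => absurd h1 h⟩
    · funext x
      rw [sSup_apply]
      rcases MVTopCat.indicator_eq {x | ∃ o ∈ G, o x = 1} x with ⟨⟨o, ho, h⟩, h'⟩ | ⟨h, h'⟩
      · rw [h']
        refine _root_.le_antisymm unitInterval.le_one' ?_
        rw [← h]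
        exact le_iSup (fun s : G => s.1 x) ⟨o, ho⟩
      · rw [h']
        refine _root_.le_antisymm (iSup_le ?_) unitInterval.nonneg'
        rintro ⟨o, ho⟩
        obtain ⟨U, hU, rfl⟩ := hG ho
        rcases MVTopCat.indicator_eq U x with ⟨h1, h1'⟩ | ⟨h1, h1'⟩
        · exact absurd ⟨_, ho, h1'⟩ h
        · exact h1'.le
  odot_mem := by
    rintro _ ⟨U, hU, rfl⟩ _ ⟨V, hV, rfl⟩
    refine ⟨U ∩ V, hU.inter hV, ?_⟩
    funext x
    apply Subtype.ext
    change ((U.indicator (fun _ => (1 : unitInterval)) x ⊙ᵐ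
      V.indicator (fun _ => (1 : unitInterval)) x : unitInterval) : ℝ) = _
    rw [coe_odot]
    by_cases h : x ∈ U <;> by_cases h' : x ∈ V <;> simp [Set.indicator, h, h']
  oplus_mem := by
    rintro _ ⟨U, hU, rfl⟩ _ ⟨V, hV, rfl⟩
    refine ⟨U ∪ V, hU.union hV, ?_⟩
    funext x
    apply Subtype.ext
    change ((U.indicator (fun _ => (1 : unitInterval)) x ⊕ᵐ
      V.indicator (fun _ => (1 : unitInterval)) x : unitInterval) : ℝ) = _
    rw [coe_oplus]
    by_cases h : x ∈ U <;> by_cases h' : x ∈ V <;> simp [Set.indicator, h, h']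
  inf_mem := by
    rintro _ ⟨U, hU, rfl⟩ _ ⟨V, hV, rfl⟩
    refine ⟨U ∩ V, hU.inter hV, ?_⟩
    funext x
    by_cases h : x ∈ U <;> by_cases h' : x ∈ V <;> simp [Set.indicator, h, h']

/-- The inclusion of the category of topological spaces into that of MV-topological spaces. -/
noncomputable def topToMV : TopCat.{u} ⥤ MVTopCat.{u} where
  obj X := crispSpace X
  map f :=
    { toFun := fun x => f.hom x
      continuous := by
        rintro _ ⟨U, hU, rfl⟩
        exact ⟨f.hom ⁻¹' U, hU.preimage f.hom.continuous, rfl⟩ }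

/-- The inclusion of the category of Stone spaces into that of MV-topological spaces. -/
noncomputable def stoneToMV : Profinite.{u} ⥤ MVTopCat.{u} := Profinite.toTopCat ⋙ topToMV

/-- The set of maximal ideals of a Boolean algebra. -/
def BoolMax (B : Type u) [BooleanAlgebra B] : Type u := {M : Order.Ideal B // M.IsMaximal}

/-- The underlying set of a maximal ideal. -/
def BoolMax.carrier {B : Type u} [BooleanAlgebra B] (M : BoolMax B) : Set B := {b | b ∈ M.1}

namespace BoolMax

variable {B : Type u} [BooleanAlgebra B] {B' : Type u} [BooleanAlgebra B']

instance : TopologicalSpace (BoolMax B) :=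
  TopologicalSpace.generateFrom {U | ∃ b : B, U = {M : BoolMax B | b ∉ M.1}}

theorem compl_mem_iff (M : BoolMax B) (b : B) : bᶜ ∈ M.1 ↔ b ∉ M.1 := by
  have := M.2
  constructor
  · intro h h'
    have h1 := Order.Ideal.sup_mem h h'
    rw [compl_sup_eq_top] at h1
    exact (Order.Ideal.IsProper.top_notMem inferInstance) h1
  · exact Order.Ideal.IsPrime.compl_mem_of_notMem inferInstance

/-- The clopen set `{M | b ∉ M}`. -/
def basic (b : B) : TopologicalSpace.Clopens (BoolMax B) where
  carrier := {M | b ∉ M.1}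
  isClopen' := by
    constructor
    · rw [← isOpen_compl_iff]
      have : {M : BoolMax B | b ∉ M.1}ᶜ = {M | bᶜ ∉ M.1} := by
        ext M; simp [compl_mem_iff]
      rw [this]
      exact TopologicalSpace.isOpen_generateFrom_of_mem ⟨bᶜ, rfl⟩
    · exact TopologicalSpace.isOpen_generateFrom_of_mem ⟨b, rfl⟩

instance : TotallySeparatedSpace (BoolMax B) where
  isTotallySeparated_univ := by
    intro M _ N _ hne
    have : ∃ b, b ∈ M.1 ∧ b ∉ N.1 := by
      by_contra hc
      push Not at hc
      apply hne
      apply Subtype.ext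
      apply Order.Ideal.ext
      apply Set.Subset.antisymm hc
      intro b hb
      by_contra hb'
      exact (compl_mem_iff N b).1 (hc _ ((compl_mem_iff M b).2 hb')) hb
    obtain ⟨b, hM, hN⟩ := this
    refine ⟨_, _, (basic bᶜ).isClopen.isOpen, (basic b).isClopen.isOpen,
      fun h => (compl_mem_iff M b).1 h hM, hN, ?_, ?_⟩
    · intro K _
      by_cases h : b ∈ K.1
      · exact Or.inl fun h' => (compl_mem_iff K b).1 h' h
      · exact Or.inr h
    · rw [Set.disjoint_left]
      intro K h h'
      exact h ((compl_mem_iff K b).2 h')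

instance : CompactSpace (BoolMax B) := by
  constructor
  refine isCompact_generateFrom rfl ?_
  intro P hP hcov
  -- the ideal generated by the elements of the covering
  let S : Set B := {b | {M : BoolMax B | b ∉ M.1} ∈ P}
  by_cases h : ∃ t : Finset B, (t : Set B) ⊆ S ∧ t.sup _root_.id = ⊤
  · obtain ⟨t, ht, htop⟩ := h
    refine ⟨(fun b => {M : BoolMax B | b ∉ M.1}) '' (t : Set B), ?_, t.finite_toSet.image _, ?_⟩
    · rintro _ ⟨b, hb, rfl⟩; exact ht hb
    · intro M _
      by_contra hc
      have : ∀ b ∈ t, b ∈ M.1 := by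
        intro b hb
        by_contra hb'
        exact hc ⟨_, ⟨b, hb, rfl⟩, hb'⟩
      have h1 : t.sup _root_.id ∈ M.1 := (Order.Ideal.finsetSup_mem_iff M.1).2 this
      rw [htop] at h1
      have := M.2
      exact (Order.Ideal.IsProper.top_notMem inferInstance) h1
  · exfalso
    let I : Order.Ideal B :=
      { carrier := {x | ∃ t : Finset B, (t : Set B) ⊆ S ∧ x ≤ t.sup _root_.id}
        lower' := fun x y hyx ⟨t, ht, hx⟩ => ⟨t, ht, hyx.trans hx⟩
        nonempty' := ⟨⊥, ∅, by simp, bot_le⟩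
        directed' := by
          classical
          rintro x ⟨t, ht, hx⟩ y ⟨t', ht', hy⟩
          refine ⟨x ⊔ y, ⟨t ∪ t', by simp [ht, ht'], ?_⟩, le_sup_left, le_sup_right⟩
          rw [Finset.sup_union]
          exact sup_le_sup hx hy }
    have hI : I.IsProper := by
      apply Order.Ideal.isProper_of_notMem (p := ⊤)
      rintro ⟨t, ht, htop⟩
      exact h ⟨t, ht, top_le_iff.1 htop⟩
    obtain ⟨M, hle, hM⟩ := hI.exists_le_maximal
    have := hcov (Set.mem_univ (⟨M, hM⟩ : BoolMax B))
    obtain ⟨U, hU, hMU⟩ := this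
    obtain ⟨b, rfl⟩ := hP hU
    exact hMU (hle ⟨{b}, by rw [Finset.coe_singleton, Set.singleton_subset_iff]; exact hU, by simp⟩)

/-- The preimage of an ideal. -/
def comapIdeal (f : BoundedLatticeHom B B') (I : Order.Ideal B') : Order.Ideal B where
  carrier := {b | f b ∈ I}
  lower' := fun _ _ h hx => I.lower (OrderHomClass.mono f h) hx
  nonempty' := ⟨⊥, by change f ⊥ ∈ I; rw [map_bot]; exact I.bot_mem⟩
  directed' := fun x hx y hy => ⟨x ⊔ y, by
    change f _ ∈ I; rw [map_sup]; exact Order.Ideal.sup_mem hx hy,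
    le_sup_left, le_sup_right⟩

/-- The preimage of a maximal ideal. -/
def comap (f : BoundedLatticeHom B B') (N : BoolMax B') : BoolMax B :=
  ⟨comapIdeal f N.1, by
    have hN := N.2
    have : (comapIdeal f N.1).IsProper := by
      apply Order.Ideal.isProper_of_notMem (p := ⊤)
      change f ⊤ ∉ N.1
      rw [map_top]
      exact Order.Ideal.IsProper.top_notMem inferInstance
    have : (comapIdeal f N.1).IsPrime := by
      apply Order.Ideal.isPrime_of_mem_or_compl_mem
      intro b
      change f b ∈ N.1 ∨ f bᶜ ∈ N.1
      rw [map_compl', compl_mem_iff]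
      exact em _
    exact Order.Ideal.IsPrime.isMaximal⟩

theorem continuous_comap (f : BoundedLatticeHom B B') : Continuous (comap f) := by
  refine continuous_generateFrom_iff.2 ?_
  rintro _ ⟨b, rfl⟩
  exact (basic (f b)).isClopen.isOpen

end BoolMax

/-- The classical contravariant functor from Boolean algebras to Stone spaces, in terms of
maximal ideals. -/
def stoneMax : BoolAlg.{u}ᵒᵖ ⥤ Profinite.{u} where
  obj B := Profinite.of (BoolMax B.unop)
  map f := CompHausLike.ofHom _ ⟨BoolMax.comap f.unop.hom, BoolMax.continuous_comap _⟩

/-- The classical contravariant functor from Stone spaces to Boolean algebras: clopen sets and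
preimages. -/
def stoneClop : Profinite.{u}ᵒᵖ ⥤ BoolAlg.{u} where
  obj X := BoolAlg.of (TopologicalSpace.Clopens X.unop)
  map {X Y} f := BoolAlg.ofHom
    { toFun := fun U => ⟨(ConcreteCategory.hom f.unop) ⁻¹' U,
        U.isClopen.preimage (ConcreteCategory.hom f.unop).continuous⟩
      map_sup' := fun _ _ => rfl
      map_inf' := fun _ _ => rfl
      map_top' := rfl
      map_bot' := rfl }

/-- The set of ultrafilters of a Boolean algebra. -/
def BoolUlt (B : Type u) [BooleanAlgebra B] : Type u :=
  {F : Order.PFilter B // ⊥ ∉ F ∧ ∀ b : B, b ∈ F ∨ bᶜ ∈ F}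

/-- The underlying set of an ultrafilter. -/
def BoolUlt.carrier {B : Type u} [BooleanAlgebra B] (F : BoolUlt B) : Set B := {b | b ∈ F.1}

instance (B : Type u) [BooleanAlgebra B] : TopologicalSpace (BoolUlt B) :=
  TopologicalSpace.generateFrom {U | ∃ b : B, U = {F : BoolUlt B | b ∈ F.1}}

/-- The preimage of an ultrafilter. -/
def BoolUlt.comap {B B' : Type u} [BooleanAlgebra B] [BooleanAlgebra B']
    (f : BoundedLatticeHom B B') (F : BoolUlt B') : BoolUlt B :=
  ⟨Order.IsPFilter.toPFilter (F := {b | f b ∈ F.1}) (Order.IsPFilter.of_def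
      ⟨⊤, by change f ⊤ ∈ F.1; rw [map_top]; exact F.1.top_mem⟩
      (fun x hx y hy => ⟨x ⊓ y, by
        change f _ ∈ F.1; rw [map_inf]; exact Order.PFilter.inf_mem hx hy,
        inf_le_left, inf_le_right⟩)
      (fun {x y} h hx => Order.PFilter.mem_of_le (OrderHomClass.mono f h) hx)), by
    constructor
    · change f ⊥ ∉ F.1
      rw [map_bot]; exact F.2.1
    · intro b
      change f b ∈ F.1 ∨ f bᶜ ∈ F.1
      rw [map_compl']; exact F.2.2 _⟩

/-- The classical Stone dual, in terms of ultrafilters. -/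
def stoneUlt : BoolAlg.{u}ᵒᵖ ⥤ TopCat.{u} where
  obj B := TopCat.of (BoolUlt B.unop)
  map f := TopCat.ofHom ⟨BoolUlt.comap f.unop.hom, by
    refine continuous_generateFrom_iff.2 ?_
    rintro _ ⟨b, rfl⟩
    exact TopologicalSpace.isOpen_generateFrom_of_mem ⟨f.unop.hom b, rfl⟩⟩

end

/-! Everything rests on two dictionaries: idempotency forces `{0, 1}`-values, and a `{0, 1}`-valued
function is the same thing as a set.

On the algebraic side, `⊕` and `*` of a Boolean algebra are join and complement, so MV-ideals are
lattice ideals and the two spectra have the same points (`maxEquiv`). Since `b ⊕ b = b`, each value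
`b̂(M)` is an idempotent of `[0, 1]`, hence `0` or `1`, and it is `0` exactly when `b ∈ M`. So `b̂`
is the characteristic function of the basic clopen set of `b` (`hat_ofBooleanAlgebra`), which
identifies the MV-topology of the spectrum with the classical one. Semisimplicity follows from the
Boolean prime ideal theorem. For a limit cut `X`, the elements below some `bᶜ ⊔ a`, with `a ∈ X` and
`b ∈ uX`, form an ideal. Were it proper, a maximal ideal above it would give every `b̂ ⊖ â` the
value `1`. So `b ≤ a` for some pair, and this `b` is the supremum.

On the topological side, `charFun` turns unions, finite intersections and complements into joins,
meets and `*`. The sets with open characteristic function form a topology on any MV-space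
(`crispTopology`), and for a crisp space it determines all the open MV-sets. A join of `{0,
1}`-valued functions that is `1` at a point has a member that is `1` there, so fuzzy and classical
covers agree; with this the Stone MV-axioms for crisp spaces become compactness and total separation
(`IsCrisp.isStone`, `IsStone.compactSpace`, `IsStone.totallySeparatedSpace`).

The classical duality is proved directly: `BoolMax.basic` is bijective onto the clopen sets and
`BoolMax.ofPoint` is bijective onto the maximal ideals, so unit and counit are isomorphisms. All the
functors act by preimages, so naturality is definitional, and the comparison with the MV-maps
reduces to `charFun_eq_zero` and `charFun_eq_one`. -/

namespace BoolMax

/-! ### Maximal ideals of a Boolean algebra and the basic clopen sets. -/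

variable {B : Type u} [BooleanAlgebra B]

theorem carrier_injective : Function.Injective (carrier : BoolMax B → Set B) :=
  fun _ _ h => Subtype.ext (Order.Ideal.ext h)

theorem sup_mem_iff (M : BoolMax B) {a b : B} : a ⊔ b ∈ M.1 ↔ a ∈ M.1 ∧ b ∈ M.1 :=
  ⟨fun h => ⟨M.1.lower le_sup_left h, M.1.lower le_sup_right h⟩,
    fun h => Order.Ideal.sup_mem h.1 h.2⟩

theorem top_notMem (M : BoolMax B) : ⊤ ∉ M.1 := by
  have := M.2
  exact Order.Ideal.IsProper.top_notMem inferInstance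

/-- Primeness of a maximal ideal: it contains exactly one of `b` and `bᶜ`, so De Morgan reduces
meets to joins. -/
theorem inf_mem_iff (M : BoolMax B) {a b : B} : a ⊓ b ∈ M.1 ↔ a ∈ M.1 ∨ b ∈ M.1 := by
  rw [← not_iff_not, ← compl_mem_iff, compl_inf, sup_mem_iff, compl_mem_iff, compl_mem_iff, not_or]

/-- An element of `N` outside `M` would have its complement in `M`, hence in `N`, which is
impossible. -/
theorem eq_of_carrier_subset {M N : BoolMax B} (h : M.carrier ⊆ N.carrier) : M = N := by
  refine carrier_injective (h.antisymm fun b hb => ?_)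
  by_contra hb'
  exact (compl_mem_iff N b).1 (h ((compl_mem_iff M b).2 hb')) hb

/-- An ideal that does not contain `⊤` extends to a maximal one. -/
theorem exists_le {I : Order.Ideal B} (h : ⊤ ∉ I) : ∃ M : BoolMax B, I ≤ M.1 := by
  have := Order.Ideal.isProper_of_notMem h
  obtain ⟨M, hle, hM⟩ := this.exists_le_maximal
  exact ⟨⟨M, hM⟩, hle⟩

/-- The principal ideal of `bᶜ` is proper, and a maximal ideal that contains `bᶜ` cannot contain
`b`. -/
theorem exists_notMem {b : B} (h : b ≠ ⊥) : ∃ M : BoolMax B, b ∉ M.1 := by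
  have : ⊤ ∉ Order.Ideal.principal bᶜ := by
    rw [Order.Ideal.mem_principal, top_le_iff, compl_eq_top]
    exact h
  obtain ⟨M, hM⟩ := exists_le this
  exact ⟨M, (compl_mem_iff M b).1 (hM (Order.Ideal.mem_principal.2 le_rfl))⟩

/-- If `a ≰ b`, then `a ⊓ bᶜ` is nonzero and is avoided by some maximal ideal. By primeness this
ideal avoids `a` and contains `b`, so it separates the two basic sets. -/
theorem basic_injective : Function.Injective (basic : B → TopologicalSpace.Clopens (BoolMax B)) := by
  have key : ∀ a b : B, basic a = basic b → a ≤ b := by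
    intro a b h
    by_contra hc
    have hne : a ⊓ bᶜ ≠ ⊥ := by rwa [← sdiff_eq, Ne, sdiff_eq_bot_iff]
    obtain ⟨M, hM⟩ := exists_notMem hne
    rw [inf_mem_iff, not_or, compl_mem_iff, not_not] at hM
    have : M ∈ basic b := h ▸ (show M ∈ basic a from hM.1)
    exact this hM.2
  exact fun a b h => (key a b h).antisymm (key b a h.symm)

theorem basic_sup (a b : B) : basic (a ⊔ b) = basic a ⊔ basic b := by
  ext M
  change a ⊔ b ∉ M.1 ↔ a ∉ M.1 ∨ b ∉ M.1
  rw [sup_mem_iff, not_and_or]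

theorem basic_inf (a b : B) : basic (a ⊓ b) = basic a ⊓ basic b := by
  ext M
  change a ⊓ b ∉ M.1 ↔ a ∉ M.1 ∧ b ∉ M.1
  rw [inf_mem_iff, not_or]

theorem isTopologicalBasis_basic :
    TopologicalSpace.IsTopologicalBasis (Set.range fun b : B => (basic b : Set (BoolMax B))) where
  exists_subset_inter := by
    rintro _ ⟨a, rfl⟩ _ ⟨b, rfl⟩ M hM
    refine ⟨_, ⟨a ⊓ b, rfl⟩, ?_, ?_⟩
    · change M ∈ basic (a ⊓ b)
      rw [basic_inf]
      exact hM
    · change (basic (a ⊓ b) : Set (BoolMax B)) ⊆ _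
      rw [basic_inf]
      exact subset_rfl
  sUnion_eq := Set.eq_univ_of_forall fun M => ⟨_, ⟨⊤, rfl⟩, M.top_notMem⟩
  eq_generateFrom := by
    change TopologicalSpace.generateFrom _ = _
    congr 1
    ext U
    exact ⟨fun ⟨b, h⟩ => ⟨b, h.symm⟩, fun ⟨b, h⟩ => ⟨b, h.symm⟩⟩

/-- A clopen set is compact and open, hence a finite union of basic sets, and it is the basic set of
the join of their indices. -/
theorem basic_surjective :
    Function.Surjective (basic : B → TopologicalSpace.Clopens (BoolMax B)) := by
  classical
  intro U
  have hcov : ∀ b : B, _root_.IsCompact (basic b : Set (BoolMax B)) :=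
    fun b => (basic b).isClopen.isClosed.isCompact
  obtain ⟨s, hs, hU⟩ := (isCompact_open_iff_eq_finite_iUnion_of_isTopologicalBasis _
    isTopologicalBasis_basic hcov (U : Set (BoolMax B))).1
      ⟨U.isClopen.isClosed.isCompact, U.isClopen.isOpen⟩
  refine ⟨hs.toFinset.sup _root_.id, ?_⟩
  ext M
  change ¬ (_ ∈ M.1) ↔ M ∈ (U : Set (BoolMax B))
  -- An ideal contains a finite join iff it contains every term, so `M` avoids the join iff it
  -- avoids some term.
  rw [Order.Ideal.finsetSup_mem_iff, hU]
  simp only [Set.mem_iUnion]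
  push Not
  simp only [Set.Finite.mem_toFinset, _root_.id]
  exact ⟨fun ⟨b, hb, h⟩ => ⟨b, hb, h⟩, fun ⟨b, hb, h⟩ => ⟨b, hb, h⟩⟩

/-! ### Points of a space as maximal ideals of its clopen sets. -/

/-- A proper ideal that contains every element or its complement is maximal. -/
def ofIdeal (I : Order.Ideal B) (h : ⊤ ∉ I) (h' : ∀ b, b ∈ I ∨ bᶜ ∈ I) : BoolMax B :=
  ⟨I, by
    have := Order.Ideal.isProper_of_notMem h
    have := Order.Ideal.isPrime_of_mem_or_compl_mem fun {b} => h' b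
    exact Order.Ideal.IsPrime.isMaximal⟩

/-- The maximal ideal `{U | x ∉ U}` of clopen sets. -/
def ofPoint {X : Type u} [TopologicalSpace X] (x : X) : BoolMax (TopologicalSpace.Clopens X) :=
  ofIdeal
    { carrier := {U | x ∉ U}
      lower' := fun _ _ h hx hx' => hx (h hx')
      nonempty' := ⟨⊥, fun h => h.elim⟩
      directed' := fun U hU V hV => ⟨U ⊔ V, fun h => h.elim hU hV, le_sup_left, le_sup_right⟩ }
    (fun h => h trivial) (fun _ => em _)

theorem continuous_ofPoint {X : Type u} [TopologicalSpace X] :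
    Continuous (ofPoint : X → BoolMax (TopologicalSpace.Clopens X)) := by
  refine continuous_generateFrom_iff.2 ?_
  rintro _ ⟨U, rfl⟩
  convert U.isClopen.isOpen using 1
  ext x
  exact not_not

theorem ofPoint_injective {X : Type u} [TopologicalSpace X] [TotallySeparatedSpace X] :
    Function.Injective (ofPoint : X → BoolMax (TopologicalSpace.Clopens X)) := by
  intro x y h
  by_contra hne
  obtain ⟨U, hU, hx, hy⟩ := exists_isClopen_of_totally_separated hne
  have h1 : (⟨U, hU⟩ : TopologicalSpace.Clopens X) ∈ (ofPoint y).1 := hy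
  rw [← h] at h1
  exact h1 hx

/-- By compactness some point lies in no member of `M`: otherwise finitely many members would cover
the space, and their join `⊤` would lie in `M`. Then `M` is contained in the ideal of that point,
and maximality gives equality. -/
theorem ofPoint_surjective {X : Type u} [TopologicalSpace X] [CompactSpace X] :
    Function.Surjective (ofPoint : X → BoolMax (TopologicalSpace.Clopens X)) := by
  classical
  intro M
  have : ∃ x : X, ∀ U ∈ M.1, x ∉ U := by
    by_contra hc
    push Not at hc
    obtain ⟨t, ht⟩ := isCompact_univ.elim_finite_subcover
      (fun U : {U : TopologicalSpace.Clopens X // U ∈ M.1} => (U.1 : Set X))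
      (fun U => U.1.isClopen.isOpen) (fun x _ => by
        obtain ⟨U, hU, hx⟩ := hc x
        exact Set.mem_iUnion.2 ⟨⟨U, hU⟩, hx⟩)
    have hmem : t.sup Subtype.val ∈ M.1 := (Order.Ideal.finsetSup_mem_iff M.1).2 fun U _ => U.2
    have htop : t.sup Subtype.val = (⊤ : TopologicalSpace.Clopens X) := by
      rw [eq_top_iff]
      intro x hx
      obtain ⟨U, hU, hxU⟩ := Set.mem_iUnion₂.1 (ht hx)
      exact Finset.le_sup (f := Subtype.val) hU hxU
    rw [htop] at hmem
    exact M.top_notMem hmem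
  obtain ⟨x, hx⟩ := this
  exact ⟨x, (eq_of_carrier_subset (N := ofPoint x) fun U hU => hx U hU).symm⟩

/-! ### Ultrafilters as complements of maximal ideals. -/

/-- The complement of a maximal ideal, as an ultrafilter. -/
def toUlt (M : BoolMax B) : BoolUlt B :=
  ⟨Order.IsPFilter.toPFilter (F := {b | b ∉ M.1}) (Order.IsPFilter.of_def
      ⟨⊤, M.top_notMem⟩
      (fun x hx y hy => ⟨x ⊓ y, fun h => ((inf_mem_iff M).1 h).elim hx hy,
        inf_le_left, inf_le_right⟩)
      (fun {_ _} h hx hy => hx (M.1.lower h hy))),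
    fun h => h M.1.bot_mem, fun b => by
      change b ∉ M.1 ∨ bᶜ ∉ M.1
      rw [compl_mem_iff, not_not]
      exact (em _).symm⟩

end BoolMax

namespace BoolUlt

variable {B : Type u} [BooleanAlgebra B]

theorem carrier_injective : Function.Injective (carrier : BoolUlt B → Set B) :=
  fun _ _ h => Subtype.ext (SetLike.coe_injective h)

theorem compl_mem_iff (F : BoolUlt B) (b : B) : bᶜ ∈ F.1 ↔ b ∉ F.1 := by
  refine ⟨fun h h' => F.2.1 ?_, (F.2.2 b).resolve_left⟩
  have := Order.PFilter.inf_mem h' h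
  rwa [inf_compl_eq_bot] at this

/-- The complement of an ultrafilter, as a maximal ideal. -/
def toMax (F : BoolUlt B) : BoolMax B :=
  BoolMax.ofIdeal
    { carrier := {b | b ∉ F.1}
      lower' := fun _ _ h hx hx' => hx (Order.PFilter.mem_of_le h hx')
      nonempty' := ⟨⊥, F.2.1⟩
      directed' := fun x hx y hy => ⟨x ⊔ y, by
        change x ⊔ y ∉ F.1
        -- By De Morgan, closure of the complement under joins is closure of the filter under meets.
        rw [← compl_mem_iff, compl_sup]
        exact Order.PFilter.inf_mem ((compl_mem_iff F x).2 hx) ((compl_mem_iff F y).2 hy),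
        le_sup_left, le_sup_right⟩ }
    (fun h => h F.1.top_mem) (fun b => by
      change b ∉ F.1 ∨ bᶜ ∉ F.1
      rw [compl_mem_iff, not_not]
      exact (em _).symm)

end BoolUlt

/-- Complementation is a homeomorphism from the maximal ideals onto the ultrafilters. -/
def BoolMax.homeomorphUlt (B : Type u) [BooleanAlgebra B] : BoolMax B ≃ₜ BoolUlt B where
  toFun := BoolMax.toUlt
  invFun := BoolUlt.toMax
  left_inv M := BoolMax.carrier_injective (Set.ext fun _ => not_not)
  right_inv F := BoolUlt.carrier_injective (Set.ext fun _ => not_not)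
  continuous_toFun := by
    refine continuous_generateFrom_iff.2 ?_
    rintro _ ⟨b, rfl⟩
    exact (BoolMax.basic b).isClopen.isOpen
  continuous_invFun := by
    refine continuous_generateFrom_iff.2 ?_
    rintro _ ⟨b, rfl⟩
    refine TopologicalSpace.isOpen_generateFrom_of_mem ⟨b, ?_⟩
    ext F
    exact not_not

/-! ### Idempotent MV-algebras, simplicity and semisimplicity. -/

namespace MVAlgebra

/-- In `x = min (1, 2x)` the minimum is attained either by `1`, so `x = 1`, or by `2x`, so `x = 0`.
-/
theorem unitInterval_eq_zero_or_one {x : unitInterval} (h : x ⊕ᵐ x = x) : x = 0 ∨ x = 1 := by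
  have h1 := congrArg Subtype.val h
  rw [coe_oplus, min_def] at h1
  split_ifs at h1
  · exact Or.inr (Subtype.ext h1.symm)
  · exact Or.inl (Subtype.ext (by change (x : ℝ) = 0; linarith))

/-- An MV-algebra with idempotent sum as a Boolean algebra. -/
@[reducible]
def toBooleanAlgebra (A : Type u) [MVAlgebra A] (h : ∀ a : A, a ⊕ᵐ a = a) : BooleanAlgebra A where
  le := le
  le_refl := le_refl
  le_trans _ _ _ := le_trans
  le_antisymm _ _ := le_antisymm
  sup := oplus
  le_sup_left := le_oplus_left
  le_sup_right := le_oplus_right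
  -- Here idempotency makes `⊕` a least upper bound: `a ⊕ b ≼ c ⊕ c = c`.
  sup_le a b c hac hbc := h c ▸ oplus_le_oplus hac hbc
  inf := inf
  inf_le_left := inf_le_left
  inf_le_right := inf_le_right
  le_inf _ _ _ := le_inf
  -- Distributivity comes from residuation: subtracting `a` from a lower bound of `a ⊕ b` and `a ⊕
  -- c` leaves something below both `b` and `c`.
  le_sup_inf a _ _ := ominus_le_iff.1
    (le_inf (ominus_le_iff.2 (inf_le_left _ _)) (ominus_le_iff.2 (inf_le_right _ _)))
  top := one
  bot := zero
  compl := star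
  le_top := le_one
  bot_le := zero_le
  inf_compl_le_bot a := by
    change inf a a⋆ ≼ zero
    -- `a ∧ a* = a ⊙ (a* ⊕ a*)`, and idempotency turns this into `a ⊙ a* = 0`.
    rw [inf_eq, h, odot_star_self]
    exact le_refl _
  top_le_sup_compl a := by
    change one ≼ a ⊕ᵐ a⋆
    rw [oplus_star_self]
    exact le_refl _

/-- The quotient by a maximal ideal is simple. -/
theorem isSimple_quotient {A : Type u} [MVAlgebra A] {M : MVIdeal A} (hM : M.IsMaximal) :
    IsSimple (MVQuotient M) := by
  intro I
  rw [MVIdeal.isProper_iff]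
  constructor
  · intro h1
    refine Set.eq_singleton_iff_unique_mem.2 ⟨I.zero_mem, fun x hx => ?_⟩
    by_contra hne
    -- Some multiple of a nonzero `x` is `1`, so an ideal that contains `x` is improper.
    obtain ⟨n, hn⟩ := MVQuotient.exists_nmul hM x hne
    exact h1 (hn ▸ I.nmul_mem hx n)
  · intro h h1
    have : (one : MVQuotient M) ∈ I.carrier := h1
    rw [h] at this
    exact MVQuotient.zero_ne_one hM this.symm

/-- If the maximal ideals have intersection `{0}`, then the algebra is semisimple. -/
theorem isSemisimple_of_hat_injective {A : Type u} [MVAlgebra A]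
    (h : Function.Injective (MaxSpec.hat A)) : IsSemisimple A := by
  refine ⟨MaxSpec A, fun M => ⟨MVQuotient M.1⟩, fun M => isSimple_quotient M.2,
    ⟨fun a M => MVQuotient.proj M.1 a, fun _ _ => rfl, fun _ => rfl, rfl⟩, fun a b hab => h ?_,
    fun M => MVQuotient.proj_surjective M.1⟩
  funext M
  -- `â(M)` depends only on the class of `a` modulo `M`, so equal classes at all `M` give equal
  -- functions.
  exact congrArg (MaxSpec.embed M) (congrFun hab M)

/-! ### A Boolean algebra as an MV-algebra: ideals, the functions `b̂`, limit cuts. -/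

section Boolean

attribute [local instance] ofBooleanAlgebra

variable {B : Type u} [BooleanAlgebra B]

theorem ofBooleanAlgebra_le {a b : B} : a ≼ b ↔ a ≤ b := by
  change aᶜ ⊔ b = ⊥ᶜ ↔ _
  rw [compl_bot, _root_.sup_comm, ← himp_eq, himp_eq_top_iff]

theorem ofBooleanAlgebra_ominus (a b : B) : a ⊖ᵐ b = a ⊓ bᶜ := by
  change (aᶜ ⊔ bᶜᶜ)ᶜ = _
  rw [compl_sup, compl_compl, compl_compl]

/-- The ideals of a Boolean algebra are those of the MV-algebra. -/
def idealEquiv (B : Type u) [BooleanAlgebra B] : MVIdeal B ≃ Order.Ideal B where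
  toFun I :=
    { carrier := I.carrier
      lower' := fun _ _ h hx => I.mem_of_le (ofBooleanAlgebra_le.2 h) hx
      nonempty' := ⟨⊥, I.zero_mem⟩
      directed' := fun x hx y hy => ⟨x ⊔ y, I.oplus_mem hx hy,
        _root_.le_sup_left, _root_.le_sup_right⟩ }
  invFun I :=
    { carrier := {b | b ∈ I}
      zero_mem := I.bot_mem
      oplus_mem := fun ha hb => Order.Ideal.sup_mem ha hb
      mem_of_le := fun h hb => I.lower (ofBooleanAlgebra_le.1 h) hb }
  left_inv _ := rfl
  right_inv _ := rfl

/-- Reconciles two forms of maximality: every proper ideal above `I` equals `I`, and every ideal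
strictly above `I` is the whole algebra. -/
theorem isMaximal_idealEquiv (I : MVIdeal B) : I.IsMaximal ↔ (idealEquiv B I).IsMaximal := by
  constructor
  · rintro ⟨h, h'⟩
    refine @Order.Ideal.IsMaximal.mk _ _ _ ⟨h⟩ fun J hJ => ?_
    by_contra hc
    exact hJ.ne (congrArg (idealEquiv B) (h' ((idealEquiv B).symm J) hc hJ.le))
  · intro h
    refine ⟨h.ne_univ, fun J hJ hle => ?_⟩
    by_contra hne
    exact hJ (h.maximal_proper (J := idealEquiv B J)
      (lt_of_le_of_ne hle fun e => hne ((idealEquiv B).injective e)))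

/-- The maximal ideals of a Boolean algebra are those of the MV-algebra. -/
def maxEquiv (B : Type u) [BooleanAlgebra B] : MaxSpec B ≃ BoolMax B :=
  (idealEquiv B).subtypeEquiv isMaximal_idealEquiv

/-- Evaluation at `M` is a homomorphism, so it sends the idempotent `b` to an idempotent of `[0,
1]`, that is to `0` or `1`. The value `0` is taken exactly on members of `M`. -/
theorem hat_ofBooleanAlgebra (b : B) (M : BoolMax B) :
    MaxSpec.hat B b ((maxEquiv B).symm M) =
      (BoolMax.basic b : Set (BoolMax B)).indicator (fun _ => (1 : unitInterval)) M := by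
  have h0 := MaxSpec.hat_eq_zero b ((maxEquiv B).symm M)
  have h1 := congrFun ((MaxSpec.hat B).map_oplus b b) ((maxEquiv B).symm M)
  have hb : b ⊕ᵐ b = b := sup_idem b
  rw [hb] at h1
  rcases MVTopCat.indicator_eq (BoolMax.basic b : Set (BoolMax B)) M with ⟨h, e⟩ | ⟨h, e⟩
  · rw [e]
    exact (unitInterval_eq_zero_or_one h1.symm).resolve_left fun h2 => h (h0.1 h2)
  · rw [e]
    exact h0.2 (not_not.1 h)

theorem hat_ofBooleanAlgebra_comp_symm (b : B) :
    MaxSpec.hat B b ∘ (maxEquiv B).symm =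
      (BoolMax.basic b : Set (BoolMax B)).indicator fun _ => (1 : unitInterval) :=
  funext (hat_ofBooleanAlgebra b)

theorem hat_injective_ofBooleanAlgebra : Function.Injective (MaxSpec.hat B) := by
  intro a b h
  have := hat_ofBooleanAlgebra_comp_symm a
  rw [h, hat_ofBooleanAlgebra_comp_symm b] at this
  exact BoolMax.basic_injective (SetLike.coe_injective
    (Set.indicator_one_inj unitInterval this.symm))

/-- Boolean algebras are limit cut complete. -/
theorem isLCC_ofBooleanAlgebra : IsLCC B := by
  refine ⟨isSemisimple_of_hat_injective hat_injective_ofBooleanAlgebra, fun X hX => ?_⟩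
  obtain ⟨hcut, hlim⟩ := hX
  have hmem : ∀ {x : B}, x ∈ X ↔ ∀ b ∈ upper X, x ≤ b := by
    intro x
    -- `X` occurs on both sides of `hcut` and inside `upper X`; only the membership on the left is
    -- to be rewritten.
    conv_lhs => rw [hcut]
    exact forall₂_congr fun b _ => ofBooleanAlgebra_le
  have hle : ∀ {a b : B}, a ∈ X → b ∈ upper X → a ≤ b := fun ha hb => hmem.1 ha _ hb
  -- The ideal generated by the complements `bᶜ ⊔ a` of the differences `b ⊖ a`. It is directed
  -- because the cut `X` is closed under joins and `upper X` under meets.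
  let I : Order.Ideal B :=
    { carrier := {x | ∃ a ∈ X, ∃ b ∈ upper X, x ≤ bᶜ ⊔ a}
      lower' := fun _ _ h ⟨a, ha, b, hb, hx⟩ => ⟨a, ha, b, hb, h.trans hx⟩
      nonempty' := ⟨⊥, ⊥, hmem.2 fun _ _ => bot_le, ⊤,
        fun _ _ => ofBooleanAlgebra_le.2 le_top, bot_le⟩
      directed' := by
        rintro x ⟨a, ha, b, hb, hx⟩ y ⟨a', ha', b', hb', hy⟩
        refine ⟨x ⊔ y, ⟨a ⊔ a', hmem.2 fun c hc => _root_.sup_le (hle ha hc) (hle ha' hc), b ⊓ b',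
          fun c hc => ofBooleanAlgebra_le.2 (_root_.le_inf (hle hc hb) (hle hc hb')), ?_⟩,
          _root_.le_sup_left, _root_.le_sup_right⟩
        rw [compl_inf, sup_sup_sup_comm]
        exact sup_le_sup hx hy }
  by_cases htop : ⊤ ∈ I
  -- Now `bᶜ ⊔ a = ⊤` for one pair, that is `b ≤ a`. As `a` is below every upper bound, `b` is the
  -- least one.
  · obtain ⟨a, ha, b, hb, h⟩ := htop
    rw [_root_.sup_comm, ← himp_eq, top_le_iff, himp_eq_top_iff] at h
    exact ⟨b, hb, fun c hc => ofBooleanAlgebra_le.2 (h.trans (hle ha hc))⟩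
  · exfalso
    -- A maximal ideal above `I` contains every `(b ⊖ a)ᶜ`, so no `b ⊖ a`. All the differences then
    -- have value `1` at this point, against the infimum being `0`.
    obtain ⟨M, hM⟩ := BoolMax.exists_le htop
    have h1 : (1 : unitInterval) ≤ sInf {d : MaxSpec B → unitInterval |
        ∃ a ∈ X, ∃ b ∈ upper X, d = MaxSpec.hat B b ⊖ᵐ MaxSpec.hat B a}
          ((maxEquiv B).symm M) := by
      rw [sInf_apply]
      refine le_iInf ?_
      rintro ⟨_, a, ha, b, hb, rfl⟩
      change 1 ≤ (MaxSpec.hat B b ⊖ᵐ MaxSpec.hat B a) ((maxEquiv B).symm M)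
      rw [← MVHom.map_ominus, hat_ofBooleanAlgebra, Set.indicator_of_mem]
      change b ⊖ᵐ a ∉ M.1
      rw [← BoolMax.compl_mem_iff, ofBooleanAlgebra_ominus, compl_inf, compl_compl]
      exact hM ⟨a, ha, b, hb, le_rfl⟩
    rw [hlim] at h1
    exact absurd (show (1 : unitInterval) ≤ 0 from h1) (not_le.2 zero_lt_one)

end Boolean

end MVAlgebra

/-! ### Boolean algebras as a full subcategory of MV-algebras. -/

theorem MVAlgCat.idempotent_of_iso {A A' : MVAlgCat.{u}} (e : A ≅ A')
    (h : ∀ a : A.carrier, a ⊕ᵐ a = a) (a : A'.carrier) : a ⊕ᵐ a = a := by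
  have h1 : e.hom.toFun (e.inv.toFun a) = a := congrFun (congrArg MVHom.toFun e.inv_hom_id) a
  rw [← h1, ← e.hom.map_oplus, h]

instance : boolToMV.{u}.Faithful where
  map_injective h := by
    ext b
    exact congrFun (congrArg MVHom.toFun h) b

instance : boolToMV.{u}.Full where
  map_surjective {B B'} f := by
    -- Retyping the map between the Boolean carriers lets the MV-laws be read as preservation of
    -- `⊔`, complement and `⊥`. Meets and `⊤` then follow by De Morgan.
    obtain ⟨g, hg⟩ : ∃ g : B → B', g = f.toFun := ⟨_, rfl⟩
    have hsup : ∀ a b, g (a ⊔ b) = g a ⊔ g b := hg ▸ f.map_oplus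
    have hcompl : ∀ a, g aᶜ = (g a)ᶜ := hg ▸ f.map_star
    have hbot : g ⊥ = ⊥ := hg ▸ f.map_zero
    exact ⟨BoolAlg.ofHom
      { toFun := g
        map_sup' := hsup
        map_inf' := fun a b => by
          have : a ⊓ b = (aᶜ ⊔ bᶜ)ᶜ := by rw [compl_sup, compl_compl, compl_compl]
          rw [this, hcompl, hsup, hcompl, hcompl, compl_sup, compl_compl, compl_compl]
        map_top' := by rw [← compl_bot, hcompl, hbot, compl_bot]
        map_bot' := hbot }, MVHom.ext hg⟩

theorem essImage_boolToMV (A : MVAlgCat.{u}) :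
    boolToMV.{u}.essImage A ↔ ∀ a : A.carrier, a ⊕ᵐ a = a := by
  constructor
  · rintro ⟨B, ⟨e⟩⟩
    exact MVAlgCat.idempotent_of_iso e fun b => sup_idem (α := B) b
  · intro h
    -- The MV-structure of this Boolean algebra has by definition the original `⊕`, `*` and `0`, so
    -- the identity map is an isomorphism.
    let _ := MVAlgebra.toBooleanAlgebra A.carrier h
    refine ⟨BoolAlg.of A.carrier, ⟨?_⟩⟩
    exact
      { hom := ⟨fun a => a, fun _ _ => rfl, fun _ => rfl, rfl⟩
        inv := ⟨fun a => a, fun _ _ => rfl, fun _ => rfl, rfl⟩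
        hom_inv_id := rfl
        inv_hom_id := rfl }

/-! ### Characteristic functions. -/

/-- The characteristic function of a set. -/
noncomputable def charFun {X : Type u} (U : Set X) : X → unitInterval :=
  U.indicator fun _ => (1 : unitInterval)

section CharFun

variable {X : Type u}

theorem charFun_of_mem {U : Set X} {x : X} (h : x ∈ U) : charFun U x = 1 :=
  Set.indicator_of_mem h _

theorem charFun_of_notMem {U : Set X} {x : X} (h : x ∉ U) : charFun U x = 0 :=
  Set.indicator_of_notMem h _

theorem charFun_eq_one {U : Set X} {x : X} : charFun U x = 1 ↔ x ∈ U := by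
  refine ⟨fun h => ?_, charFun_of_mem⟩
  by_contra hx
  rw [charFun_of_notMem hx] at h
  exact zero_ne_one h

theorem charFun_injective : Function.Injective (charFun : Set X → X → unitInterval) := by
  intro U V h
  ext x
  rw [← charFun_eq_one, h, charFun_eq_one]

theorem charFun_eq_zero {U : Set X} {x : X} : charFun U x = 0 ↔ x ∉ U := by
  refine ⟨fun h hx => ?_, charFun_of_notMem⟩
  rw [charFun_of_mem hx] at h
  exact one_ne_zero h

theorem eq_charFun {o : X → unitInterval} (h : ∀ x, o x = 0 ∨ o x = 1) :
    o = charFun {x | o x = 1} := by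
  funext x
  rcases h x with h0 | h1
  · rw [h0, charFun_of_notMem]
    exact fun h1 => zero_ne_one (h0.symm.trans h1)
  · rw [h1]
    exact (charFun_of_mem h1).symm

theorem charFun_compl (U : Set X) : charFun Uᶜ = (charFun U)⋆ := by
  funext x
  change _ = (charFun U x)⋆
  apply Subtype.ext
  rw [MVAlgebra.coe_star]
  by_cases h : x ∈ U
  · rw [charFun_of_mem h, charFun_of_notMem (not_not_intro h)]
    exact (sub_self _).symm
  · rw [charFun_of_notMem h, charFun_of_mem h]
    exact (sub_zero _).symm

theorem charFun_univ : charFun (Set.univ : Set X) = MVAlgebra.one :=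
  funext fun x => (charFun_of_mem (Set.mem_univ x)).trans (Subtype.ext MVAlgebra.coe_one.symm)

theorem charFun_empty : charFun (∅ : Set X) = MVAlgebra.zero :=
  funext fun x => charFun_of_notMem (Set.notMem_empty x)

theorem charFun_inter (U V : Set X) : charFun (U ∩ V) = charFun U ⊓ charFun V := by
  funext x
  rw [Pi.inf_apply]
  by_cases h : x ∈ U
  · by_cases h' : x ∈ V
    · rw [charFun_of_mem h, charFun_of_mem h', charFun_of_mem (Set.mem_inter h h'), inf_idem]
    · rw [charFun_of_notMem h', charFun_of_notMem fun hx => h' hx.2]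
      exact (inf_eq_right.2 unitInterval.nonneg').symm
  · rw [charFun_of_notMem h, charFun_of_notMem fun hx => h hx.1]
    exact (inf_eq_left.2 unitInterval.nonneg').symm

theorem charFun_union (U V : Set X) : charFun (U ∪ V) = charFun U ⊕ᵐ charFun V := by
  funext x
  change _ = charFun U x ⊕ᵐ charFun V x
  by_cases h : x ∈ U
  · rw [charFun_of_mem h, charFun_of_mem (Set.mem_union_left V h), show (1 : unitInterval) = MVAlgebra.one from
      Subtype.ext MVAlgebra.coe_one.symm, MVAlgebra.one_oplus]
  · rw [charFun_of_notMem h, show (0 : unitInterval) = MVAlgebra.zero from rfl,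
      MVAlgebra.zero_oplus]
    by_cases h' : x ∈ V
    · rw [charFun_of_mem h', charFun_of_mem (Set.mem_union_right U h')]
    · rw [charFun_of_notMem h', charFun_of_notMem fun hx => hx.elim h h']

theorem charFun_sUnion (S : Set (Set X)) : charFun (⋃₀ S) = sSup (charFun '' S) := by
  funext x
  rw [sSup_apply]
  by_cases h : x ∈ ⋃₀ S
  · obtain ⟨U, hU, hx⟩ := h
    rw [charFun_of_mem (Set.mem_sUnion.2 ⟨U, hU, hx⟩)]
    refine le_antisymm ?_ unitInterval.le_one'
    rw [← charFun_of_mem hx]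
    exact le_iSup (fun o : charFun '' S => o.1 x) ⟨_, U, hU, rfl⟩
  · rw [charFun_of_notMem h]
    refine le_antisymm unitInterval.nonneg' (iSup_le ?_)
    rintro ⟨_, U, hU, rfl⟩
    exact (charFun_of_notMem fun hx => h ⟨U, hU, hx⟩).le

/-- If the join of a family of `{0, 1}`-valued functions is `1` at a point, then so is a member. -/
theorem exists_eq_one_of_sSup {G : Set (X → unitInterval)} (hG : ∀ o ∈ G, ∀ x, o x = 0 ∨ o x = 1)
    {x : X} (h : sSup G x = 1) : ∃ o ∈ G, o x = 1 := by
  by_contra hc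
  have : sSup G x ≤ 0 := by
    rw [sSup_apply]
    refine iSup_le ?_
    rintro ⟨o, ho⟩
    exact ((hG o ho x).resolve_right fun h1 => hc ⟨o, ho, h1⟩).le
  rw [h] at this
  exact absurd this (not_le.2 zero_lt_one)

/-- Truncation at `1` absorbs any further summands. Together with `foldr_oplus_apply_eq_zero` this
makes additive coverings by crisp sets the same as finite subcovers. -/
theorem foldr_oplus_apply_eq_one {l : List (X → unitInterval)} {o : X → unitInterval} (ho : o ∈ l)
    {x : X} (h : o x = 1) : l.foldr MVAlgebra.oplus MVAlgebra.zero x = 1 := by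
  have h1 : (1 : unitInterval) = MVAlgebra.one := Subtype.ext MVAlgebra.coe_one.symm
  rw [h1] at h ⊢
  induction l with
  | nil => exact absurd ho List.not_mem_nil
  | cons p l ih =>
    change p x ⊕ᵐ l.foldr MVAlgebra.oplus MVAlgebra.zero x = _
    rcases List.mem_cons.1 ho with rfl | ho
    · rw [h, MVAlgebra.one_oplus]
    · rw [ih ho, MVAlgebra.oplus_one]

theorem foldr_oplus_apply_eq_zero {l : List (X → unitInterval)} {x : X} (h : ∀ o ∈ l, o x = 0) :
    l.foldr MVAlgebra.oplus MVAlgebra.zero x = 0 := by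
  induction l with
  | nil => rfl
  | cons p l ih =>
    change p x ⊕ᵐ l.foldr MVAlgebra.oplus MVAlgebra.zero x = _
    rw [h p List.mem_cons_self, ih fun o ho => h o (List.mem_cons_of_mem _ ho)]
    exact MVAlgebra.oplus_zero _

end CharFun

/-! ### Crisp MV-spaces and ordinary topologies. -/

theorem mem_opens_crispSpace {X : Type u} [TopologicalSpace X] {U : Set X} :
    charFun U ∈ (crispSpace X).opens ↔ IsOpen U := by
  constructor
  · rintro ⟨V, hV, h⟩
    exact charFun_injective h ▸ hV
  · exact fun h => ⟨U, h, rfl⟩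

theorem isCrisp_crispSpace (X : Type u) [TopologicalSpace X] : (crispSpace X).IsCrisp := by
  rintro _ ⟨U, hU, rfl⟩ x
  exact (MVTopCat.indicator_eq U x).symm.imp And.right And.right

namespace MVTopCat

/-- The sets whose characteristic functions are open. -/
@[reducible]
def crispTopology (τ : MVTopCat.{u}) : TopologicalSpace τ.carrier where
  IsOpen U := charFun U ∈ τ.opens
  isOpen_univ := by
    rw [charFun_univ]
    exact τ.one_mem
  isOpen_inter U V hU hV := by
    rw [charFun_inter]
    exact τ.inf_mem _ hU _ hV
  isOpen_sUnion S hS := by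
    rw [charFun_sUnion]
    refine τ.sSup_mem _ ?_
    rintro _ ⟨U, hU, rfl⟩
    exact hS U hU

attribute [local instance] crispTopology

variable {τ : MVTopCat.{u}}

theorem isOpen_crispTopology {U : Set τ.carrier} : IsOpen U ↔ charFun U ∈ τ.opens := Iff.rfl

theorem charFun_mem_clopens {U : Set τ.carrier} :
    charFun U ∈ τ.opens ∩ τ.closeds ↔ IsClopen U := by
  rw [Set.mem_inter_iff, mem_closeds, ← charFun_compl, ← isOpen_crispTopology,
    ← isOpen_crispTopology, isOpen_compl_iff, and_comm]
  rfl

theorem IsCrisp.isOpen (h : τ.IsCrisp) {o : τ.carrier → unitInterval} (ho : o ∈ τ.opens) :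
    IsOpen {x | o x = 1} := by
  rwa [isOpen_crispTopology, ← eq_charFun (h o ho)]

theorem IsCrisp.isClopen (h : τ.IsCrisp) {o : τ.carrier → unitInterval}
    (ho : o ∈ τ.opens ∩ τ.closeds) : IsClopen {x | o x = 1} := by
  rwa [← charFun_mem_clopens, ← eq_charFun (h o ho.1)]

/-- The sets `{o = 1}` of a covering cover the space, since a crisp join attains the value `1`, and
a finite subcover sums to `1`. Points are separated by a clopen set and its complement, and the
clopen sets form a base of a compact totally separated space. -/
theorem IsCrisp.isStone (h : τ.IsCrisp) [CompactSpace τ.carrier] [TotallySeparatedSpace τ.carrier] :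
    τ.IsStone := by
  classical
  refine ⟨fun Γ hΓ h1 => ?_, fun x y hne => ?_, τ.opens ∩ τ.closeds, subset_rfl,
    Set.inter_subset_left, fun o ho => ?_⟩
  · obtain ⟨t, ht⟩ := isCompact_univ.elim_finite_subcover
      (fun o : Γ => {x | o.1 x = 1}) (fun o => h.isOpen (hΓ o.2)) (fun x _ => by
        have : sSup Γ x = 1 := by rw [h1]; exact Subtype.ext MVAlgebra.coe_one
        obtain ⟨o, ho, hx⟩ := exists_eq_one_of_sSup (fun o ho => h o (hΓ ho)) this
        exact Set.mem_iUnion.2 ⟨⟨o, ho⟩, hx⟩)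
    refine ⟨t.toList.map Subtype.val, ?_, ?_⟩
    · intro o ho
      obtain ⟨o, -, rfl⟩ := List.mem_map.1 ho
      exact o.2
    · rw [← charFun_univ]
      funext x
      rw [charFun_of_mem (Set.mem_univ x)]
      obtain ⟨o, hot, hx⟩ := Set.mem_iUnion₂.1 (ht (Set.mem_univ x))
      exact foldr_oplus_apply_eq_one (List.mem_map.2 ⟨o, Finset.mem_toList.2 hot, rfl⟩) hx
  · obtain ⟨U, hU, hx, hy⟩ := exists_isClopen_of_totally_separated hne
    refine ⟨_, hU.isOpen, _, hU.compl.isOpen, charFun_of_mem hx, charFun_of_mem hy, ?_⟩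
    rw [← charFun_inter, Set.inter_compl_self, charFun_empty]
  · obtain ⟨S, hS, e⟩ := isTopologicalBasis_isClopen.open_eq_sUnion (h.isOpen ho)
    refine ⟨charFun '' S, ?_, ?_⟩
    · rintro _ ⟨U, hU, rfl⟩
      exact charFun_mem_clopens.2 (hS hU)
    · rw [← charFun_sUnion, ← e]
      exact eq_charFun (h o ho)

/-- Additive compactness is applied to the characteristic functions of an open cover: at a point
missed by the sets selected, every summand vanishes, so the sum could not be `1`. -/
theorem IsStone.compactSpace (h : τ.IsStone) : CompactSpace τ.carrier := by
  classical
  refine ⟨isCompact_of_finite_subcover fun {ι} U hU hcov => ?_⟩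
  obtain ⟨l, hl, h1⟩ := h.1 (charFun '' Set.range U)
    (by rintro _ ⟨_, ⟨i, rfl⟩, rfl⟩; exact hU i)
    (by rw [← charFun_sUnion, Set.sUnion_range, Set.univ_subset_iff.1 hcov, charFun_univ])
  -- Each summand is the characteristic function of some member of the cover; one index is chosen
  -- per summand.
  have hidx : ∀ o : {o // o ∈ l}, ∃ i, charFun (U i) = o.1 := fun o => by
    obtain ⟨_, ⟨i, rfl⟩, hi⟩ := hl o.1 o.2
    exact ⟨i, hi⟩
  choose idx hidx using hidx
  refine ⟨(l.attach.map idx).toFinset, fun x _ => ?_⟩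
  by_contra hc
  have h0 : ∀ o ∈ l, o x = 0 := fun o ho => by
    refine (congrFun (hidx ⟨o, ho⟩) x).symm.trans ?_
    refine charFun_of_notMem fun hx => hc (Set.mem_iUnion₂.2 ⟨_, ?_, hx⟩)
    exact List.mem_toFinset.2 (List.mem_map_of_mem (List.mem_attach _ _))
  have h2 := foldr_oplus_apply_eq_zero h0
  rw [h1, ← charFun_univ, charFun_of_mem (Set.mem_univ x)] at h2
  exact one_ne_zero h2

/-- An open `o` that separates `x` from `y` need not be clopen, but it is a join of clopens. By
crispness one of them is `1` at `x`, and it vanishes at `y` along with `o`. -/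
theorem IsStone.totallySeparatedSpace (h : τ.IsStone) (hc : τ.IsCrisp) :
    TotallySeparatedSpace τ.carrier := by
  rw [totallySeparatedSpace_iff_exists_isClopen]
  intro x y hne
  obtain ⟨o, ho, p, hp, hx, hy, hop⟩ := h.2.1 x y hne
  obtain ⟨Θ, hΘ, -, hbase⟩ := h.2.2
  obtain ⟨G, hG, rfl⟩ := hbase o ho
  obtain ⟨c, hcG, hcx⟩ := exists_eq_one_of_sSup (fun c hcG => hc c (hΘ (hG hcG)).1) hx
  refine ⟨_, hc.isClopen (hΘ (hG hcG)), hcx, fun hcy : c y = 1 => ?_⟩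
  have h1 : c y ≤ sSup G y := le_sSup hcG y
  have h2 : (sSup G ⊓ p) y = 0 := by rw [hop]; rfl
  -- Since `p y = 1`, disjointness forces the value of `sSup G` at `y` to be `0`.
  rw [Pi.inf_apply, hy, inf_eq_left.2 unitInterval.le_one'] at h2
  rw [h2, hcy] at h1
  exact absurd h1 (not_le.2 zero_lt_one)

theorem IsCrisp.of_iso {τ' : MVTopCat.{u}} (e : τ ≅ τ') (h : τ.IsCrisp) : τ'.IsCrisp := by
  intro o ho x
  have h1 : e.hom.toFun (e.inv.toFun x) = x := congrFun (congrArg Hom.toFun e.inv_hom_id) x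
  have h2 := h _ (e.hom.continuous o ho) (e.inv.toFun x)
  rwa [Function.comp_apply, h1] at h2

/-- The composite of `charFun U` with a map is by definition the characteristic function of the
preimage of `U`. -/
theorem Hom.continuous_crispTopology {τ' : MVTopCat.{u}} (f : Hom τ τ') : Continuous f.toFun :=
  ⟨fun U hU => f.continuous (charFun U) hU⟩

/-- An isomorphism of MV-topological spaces as a homeomorphism. -/
def homeomorphOfIso {τ' : MVTopCat.{u}} (e : τ ≅ τ') : τ.carrier ≃ₜ τ'.carrier where
  toFun := e.hom.toFun
  invFun := e.inv.toFun
  left_inv := congrFun (congrArg Hom.toFun e.hom_inv_id)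
  right_inv := congrFun (congrArg Hom.toFun e.inv_hom_id)
  continuous_toFun := Hom.continuous_crispTopology e.hom
  continuous_invFun := Hom.continuous_crispTopology e.inv

end MVTopCat

theorem crispTopology_crispSpace (X : Type u) [t : TopologicalSpace X] :
    (crispSpace X).crispTopology = t :=
  TopologicalSpace.ext (funext fun _ => propext mem_opens_crispSpace)

/-! ### Stone spaces as a full subcategory of MV-topological spaces. -/

instance : topToMV.{u}.Faithful where
  map_injective h := by
    ext x
    exact congrFun (congrArg MVTopCat.Hom.toFun h) x

instance : topToMV.{u}.Full where
  map_surjective f :=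
    ⟨TopCat.ofHom ⟨f.toFun, ⟨fun U hU => mem_opens_crispSpace.1
      (f.continuous (charFun U) (mem_opens_crispSpace.2 hU))⟩⟩, rfl⟩

instance : stoneToMV.{u}.Faithful := inferInstanceAs (Profinite.toTopCat ⋙ topToMV).Faithful

instance : stoneToMV.{u}.Full := inferInstanceAs (Profinite.toTopCat ⋙ topToMV).Full

theorem essImage_stoneToMV (τ : MVTopCat.{u}) :
    stoneToMV.{u}.essImage τ ↔ τ.IsStone ∧ τ.IsCrisp := by
  let _ := τ.crispTopology
  constructor
  · rintro ⟨X, ⟨e⟩⟩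
    have hc := MVTopCat.IsCrisp.of_iso e (isCrisp_crispSpace X)
    have h1 := MVTopCat.homeomorphOfIso e
    -- The homeomorphism `h1` is for the topology recovered from `crispSpace X`, which is the
    -- original one; this lets it carry the properties of `X` over to `τ`.
    have h2 : X ≃ₜ τ.carrier := by
      have h3 := crispTopology_crispSpace X
      change @Homeomorph X τ.carrier (crispSpace X).crispTopology _ at h1
      rwa [h3] at h1
    have := h2.compactSpace
    have := h2.totallyDisconnectedSpace
    have := h2.symm.isEmbedding.t2Space
    exact ⟨hc.isStone, hc⟩
  · rintro ⟨hs, hc⟩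
    have := hs.compactSpace
    have := hs.totallySeparatedSpace hc
    refine ⟨Profinite.of τ.carrier, ⟨?_⟩⟩
    -- The identity map works: crispness makes every open MV-set the characteristic function of an
    -- open set, and the converse is the definition of `crispTopology`.
    exact
      { hom := ⟨fun x => x, fun o ho => ⟨_, hc.isOpen ho, eq_charFun (hc o ho)⟩⟩
        inv := ⟨fun x => x, by
          rintro _ ⟨U, hU, rfl⟩
          exact hU⟩
        hom_inv_id := rfl
        inv_hom_id := rfl }

/-! ### `Max` on Boolean algebras. -/

section Max

attribute [local instance] MVAlgebra.ofBooleanAlgebra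

variable (B : Type u) [BooleanAlgebra B]

theorem isOpen_maxEquiv_symm (o : MaxSpec B → unitInterval) (ho : o ∈ (MaxSpec.space B).opens) :
    o ∘ (MVAlgebra.maxEquiv B).symm ∈ (crispSpace (BoolMax B)).opens := by
  obtain ⟨G, hG, rfl⟩ := ho
  rw [sSup_comp]
  refine (crispSpace (BoolMax B)).sSup_mem _ ?_
  rintro _ ⟨t, ht, rfl⟩
  obtain ⟨b, rfl⟩ := hG ht
  exact ⟨_, (BoolMax.basic b).isClopen.isOpen, MVAlgebra.hat_ofBooleanAlgebra_comp_symm b⟩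

theorem isOpen_maxEquiv (o : BoolMax B → unitInterval) (ho : o ∈ (crispSpace (BoolMax B)).opens) :
    o ∘ MVAlgebra.maxEquiv B ∈ (MaxSpec.space B).opens := by
  obtain ⟨U, hU, rfl⟩ := ho
  -- A union of basic sets has as characteristic function the join of theirs, each of which is some
  -- `b̂`.
  obtain ⟨S, hS, rfl⟩ := BoolMax.isTopologicalBasis_basic.open_eq_sUnion hU
  have e := sSup_comp (charFun '' S) (MVAlgebra.maxEquiv B)
  rw [← charFun_sUnion] at e
  refine Set.mem_of_eq_of_mem e ?_
  refine (MaxSpec.space B).sSup_mem _ ?_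
  rintro _ ⟨_, ⟨V, hV, rfl⟩, rfl⟩
  obtain ⟨b, rfl⟩ := hS hV
  refine ⟨{MaxSpec.hat B b}, by simp, ?_⟩
  rw [sSup_singleton]
  funext M
  exact (MVAlgebra.hat_ofBooleanAlgebra b (MVAlgebra.maxEquiv B M)).symm

/-- The maximal spectrum of a Boolean algebra is the crisp space of its maximal ideals. -/
noncomputable def maxSpaceIso : MaxSpec.space B ≅ crispSpace (BoolMax B) where
  hom := ⟨MVAlgebra.maxEquiv B, isOpen_maxEquiv B⟩
  inv := ⟨(MVAlgebra.maxEquiv B).symm, isOpen_maxEquiv_symm B⟩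
  hom_inv_id := rfl
  inv_hom_id := rfl

end Max

/-- On Boolean algebras, `Max` is the classical functor. -/
noncomputable def maxIso : boolToMV.{u}.op ⋙ mvMax.{u} ≅ stoneMax.{u} ⋙ stoneToMV.{u} :=
  NatIso.ofComponents (fun B => maxSpaceIso B.unop) fun _ => rfl

/-! ### `Clop` on Stone spaces. -/

section Clop

attribute [local instance] MVAlgebra.ofBooleanAlgebra

variable (X : Type u) [TopologicalSpace X]

/-- The clopen set of which a clopen MV-subset is the characteristic function. -/
def clopToClopens : MVHom (MVTopCat.Clop (crispSpace X)) (TopologicalSpace.Clopens X) where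
  toFun o := ⟨{x | o.1 x = 1}, by
    have := (isCrisp_crispSpace X).isClopen o.2
    rwa [crispTopology_crispSpace X] at this⟩
  map_oplus a b := by
    apply TopologicalSpace.Clopens.ext
    -- Sets are compared through their characteristic functions: a crisp `o` is that of `{o = 1}`,
    -- and `⊕` corresponds to union.
    apply charFun_injective
    change _ = charFun ({x | a.1 x = 1} ∪ {x | b.1 x = 1})
    rw [charFun_union, ← eq_charFun (isCrisp_crispSpace X _ a.2.1),
      ← eq_charFun (isCrisp_crispSpace X _ b.2.1)]
    exact (eq_charFun (isCrisp_crispSpace X _ (a ⊕ᵐ b).2.1)).symm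
  map_star a := by
    apply TopologicalSpace.Clopens.ext
    apply charFun_injective
    change _ = charFun {x | a.1 x = 1}ᶜ
    rw [charFun_compl, ← eq_charFun (isCrisp_crispSpace X _ a.2.1)]
    exact (eq_charFun (isCrisp_crispSpace X _ a⋆.2.1)).symm
  map_zero := by
    apply TopologicalSpace.Clopens.ext
    exact Set.eq_empty_of_forall_notMem fun x h => zero_ne_one (α := unitInterval) h

/-- The characteristic functions of clopen sets. -/
noncomputable def clopensToClop :
    MVHom (TopologicalSpace.Clopens X) (MVTopCat.Clop (crispSpace X)) where
  toFun U := ⟨charFun (U : Set X), mem_opens_crispSpace.2 U.isClopen.isOpen, by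
    rw [MVTopCat.mem_closeds]
    exact charFun_compl (U : Set X) ▸ mem_opens_crispSpace.2 U.isClopen.compl.isOpen⟩
  map_oplus U V := Subtype.ext (charFun_union (U : Set X) V)
  map_star U := Subtype.ext (charFun_compl (U : Set X))
  map_zero := Subtype.ext charFun_empty

theorem clopensToClop_clopToClopens (o : MVTopCat.Clop (crispSpace X)) :
    clopensToClop X (clopToClopens X o) = o :=
  Subtype.ext (eq_charFun (isCrisp_crispSpace X _ o.2.1)).symm

theorem clopToClopens_clopensToClop (U : TopologicalSpace.Clopens X) :
    clopToClopens X (clopensToClop X U) = U :=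
  TopologicalSpace.Clopens.ext (Set.ext fun _ => charFun_eq_one)

end Clop

/-- On Stone spaces, `Clop` is the classical functor. -/
noncomputable def clopIso : stoneToMV.{u}.op ⋙ mvClop.{u} ≅ stoneClop.{u} ⋙ boolToMV.{u} :=
  NatIso.ofComponents
    (fun X =>
      { hom := clopToClopens X.unop
        inv := clopensToClop X.unop
        hom_inv_id := MVHom.ext (funext (clopensToClop_clopToClopens X.unop))
        inv_hom_id := MVHom.ext (funext (clopToClopens_clopensToClop X.unop)) })
    fun _ => rfl

/-! ### The classical duality. -/

/-- The isomorphism `b ↦ {M | b ∉ M}` of a Boolean algebra with the clopen sets of its Stone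
space. -/
noncomputable def BoolMax.basicIso (B : Type u) [BooleanAlgebra B] :
    B ≃o TopologicalSpace.Clopens (BoolMax B) where
  toEquiv := Equiv.ofBijective basic ⟨basic_injective, basic_surjective⟩
  map_rel_iff' {a b} := by
    -- The order is expressed by joins, which `basic` preserves; injectivity then gives both
    -- directions.
    rw [← sup_eq_right, ← sup_eq_right]
    exact (iff_of_eq (congrArg (· = basic b) (basic_sup a b).symm)).trans basic_injective.eq_iff

/-- The classical Stone duality. -/
noncomputable def stoneAdj : stoneClop.{u}.rightOp ⊣ stoneMax.{u} :=
  Adjunction.mkOfUnitCounit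
    { unit :=
        { app := fun _ => CompHausLike.ofHom _ ⟨BoolMax.ofPoint, BoolMax.continuous_ofPoint⟩
          naturality := fun _ _ _ => rfl }
      counit :=
        -- The counit lives in the opposite category, so its components are the opposites of `b ↦ {M
        -- | b ∉ M}`.
        { app := fun B => (BoolAlg.Iso.mk (BoolMax.basicIso B.unop)).hom.op
          naturality := fun _ _ _ => rfl }
      -- Unit and counit each negate membership, so both triangle identities are double negation.
      left_triangle := by
        ext X
        apply Quiver.Hom.unop_inj
        ext U
        exact TopologicalSpace.Clopens.ext (Set.ext fun x => not_not)
      right_triangle := by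
        ext B M
        exact BoolMax.carrier_injective (Set.ext fun b => not_not) }

/-- A continuous bijection of compact Hausdorff spaces is a homeomorphism. Injectivity uses total
separation, surjectivity uses compactness. -/
theorem stoneAdj_unit_isIso (X : Profinite.{u}) : IsIso (stoneAdj.unit.app X) :=
  CompHausLike.isIso_of_bijective _ ⟨BoolMax.ofPoint_injective, BoolMax.ofPoint_surjective⟩

theorem stoneAdj_counit_isIso (B : BoolAlg.{u}ᵒᵖ) : IsIso (stoneAdj.counit.app B) :=
  inferInstanceAs (IsIso (BoolAlg.Iso.mk (α := B.unop)
    (β := BoolAlg.of (TopologicalSpace.Clopens (BoolMax B.unop))) (BoolMax.basicIso B.unop)).hom.op)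

/-- Maximal ideals versus ultrafilters. -/
def maxUltIso : stoneMax.{u} ⋙ Profinite.toTopCat.{u} ≅ stoneUlt.{u} :=
  NatIso.ofComponents (fun B => TopCat.isoOfHomeo (BoolMax.homeomorphUlt B.unop)) fun _ => rfl

theorem corollary4p10 :
    -- Boolean algebras are a full subcategory of the limit cut complete MV-algebras, namely the
    -- one of the MV-algebras in which `⊕` is idempotent
    (boolToMV.{u}.Full ∧ boolToMV.{u}.Faithful ∧
      (∀ A : MVAlgCat.{u}, boolToMV.{u}.essImage A ↔ ∀ a : A.carrier, a ⊕ᵐ a = a) ∧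
      (∀ B : BoolAlg.{u}, MVAlgebra.IsLCC (boolToMV.{u}.obj B).carrier)) ∧
    -- Stone spaces are the full subcategory of the crisp Stone MV-spaces
    (stoneToMV.{u}.Full ∧ stoneToMV.{u}.Faithful ∧
      (∀ τ : MVTopCat.{u}, stoneToMV.{u}.essImage τ ↔ τ.IsStone ∧ τ.IsCrisp)) ∧
    ∃ -- on Boolean algebras, `Max` is the classical functor
      (α : boolToMV.{u}.op ⋙ mvMax.{u} ≅ stoneMax.{u} ⋙ stoneToMV.{u})
      -- on Stone spaces, `Clop` is the classical functor
      (β : stoneToMV.{u}.op ⋙ mvClop.{u} ≅ stoneClop.{u} ⋙ boolToMV.{u})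
      -- the classical duality
      (adj : stoneClop.{u}.rightOp ⊣ stoneMax.{u})
      -- maximal ideals versus ultrafilters
      (γ : stoneMax.{u} ⋙ Profinite.toTopCat.{u} ≅ stoneUlt.{u}),
      -- `α` is the identity on maximal ideals
      (∀ (B : BoolAlg.{u}) (M : MaxSpec (boolToMV.{u}.obj B).carrier) (b : B),
        b ∈ BoolMax.carrier (B := B) ((α.hom.app (op B)).toFun M) ↔ b ∈ M.carrier) ∧
      -- `β` sends a `{0, 1}`-valued clopen to the clopen set of which it is the
      -- characteristic function
      (∀ (X : Profinite.{u}) (o : MVTopCat.Clop (stoneToMV.{u}.obj X)) (x : X),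
        x ∈ TopologicalSpace.Clopens.carrier (α := X) ((β.hom.app (op X)).toFun o) ↔ o.1 x = 1) ∧
      -- the classical functors are mutually inverse dualities, with the classical unit and counit
      stoneClop.{u}.rightOp.IsEquivalence ∧ stoneMax.{u}.IsEquivalence ∧
      (∀ (X : Profinite.{u}) (x : X) (U : TopologicalSpace.Clopens X),
        U ∈ BoolMax.carrier (B := TopologicalSpace.Clopens X) (adj.unit.app X x) ↔ x ∉ U) ∧
      (∀ (B : BoolAlg.{u}) (b : B) (M : BoolMax B),
        M ∈ TopologicalSpace.Clopens.carrier (α := BoolMax B) ((adj.counit.app (op B)).unop b) ↔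
          b ∉ M.carrier) ∧
      -- they are the restrictions of the natural maps `τ → Max (Clop τ)` and `A → Clop (Max A)`
      (∀ X : Profinite.{u},
        mvUnit.{u}.app (stoneToMV.{u}.obj X) ≫ mvMax.{u}.map (β.inv.app (op X)).op ≫
          α.hom.app (op (stoneClop.{u}.obj (op X))) = stoneToMV.{u}.map (adj.unit.app X)) ∧
      (∀ B : BoolAlg.{u},
        mvCounit.{u}.app (boolToMV.{u}.obj B) ≫ mvClop.{u}.map (α.inv.app (op B)).op ≫
          β.hom.app (op (stoneMax.{u}.obj (op B))) =
            boolToMV.{u}.map (adj.counit.app (op B)).unop) ∧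
      -- `γ` sends a maximal ideal to its complement
      (∀ (B : BoolAlg.{u}) (M : BoolMax B) (b : B),
        b ∈ BoolUlt.carrier (B := B) (γ.hom.app (op B) M) ↔ b ∉ M.carrier) := by
  -- These two serve as instances that make the adjunction an equivalence.
  have h1 := stoneAdj_unit_isIso.{u}
  have h2 := stoneAdj_counit_isIso.{u}
  refine ⟨⟨inferInstance, inferInstance, essImage_boolToMV,
      fun B => MVAlgebra.isLCC_ofBooleanAlgebra (B := B)⟩,
    ⟨inferInstance, inferInstance, essImage_stoneToMV⟩,
    maxIso, clopIso, stoneAdj, maxUltIso, fun _ _ _ => Iff.rfl, fun _ _ _ => Iff.rfl,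
    stoneAdj.toEquivalence.isEquivalence_functor, stoneAdj.toEquivalence.isEquivalence_inverse,
    fun _ _ _ => Iff.rfl, fun _ _ _ => Iff.rfl, fun X => ?_, fun B => ?_, fun _ _ _ => Iff.rfl⟩
  · apply MVTopCat.Hom.ext
    funext x
    -- Traced through the identifications, the MV-unit puts `U` in the ideal of `x` when `charFun U
    -- x = 0`, the classical one when `x ∉ U`.
    refine BoolMax.carrier_injective (Set.ext fun U => ?_)
    exact charFun_eq_zero (U := TopologicalSpace.Clopens.carrier (α := X) U) (x := x)
  · apply MVHom.ext
    funext b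
    -- The MV-counit gives the set where `b̂` is `1`, and `b̂` is the characteristic function of the
    -- basic set of `b`.
    refine TopologicalSpace.Clopens.ext (Set.ext fun M => ?_)
    exact (Eq.congr_left (MVAlgebra.hat_ofBooleanAlgebra (B := B) b M)).trans charFun_eq_one
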